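/- **Setting.** Let $X\subset\mathbb{R}^D$ be a compact smooth $d$-dimensional manifold (boundary or corners allowed), and let $m$ be normalised Lebesgue measure on $X$, i.e. $d$-dimensional surface (Hausdorff) measure scaled to $m(X)=1$. Let $\xi:\mathbb{R}\times\Xi\to\Xi$ be a flow on a set $\Xi$ of generalised times, i.e. $\xi(0,z)=z$ and $\xi(s+t,z)=\xi(s,\xi(t,z))$ (no further property of $\xi$, such as an ergodic invariant probability measure, is needed). Let $F$ assign to each $z\in\Xi$ a $C^1$ tangent vector field $F(z,\cdot)$ on $X$ such that, for every $z$, the $C^1$ norm of $F(\xi(t,z),\cdot)$ is bounded by a locally integrable function of $t\in\mathbb{R}$ (for instance, $F(\xi(t,z),x)$ and its $x$-derivative are continuous in $(t,x)$). Let $\phi:\mathbb{R}\times\Xi\times X\to X$ be the flow of $\dot x(t)=F(\xi(t,z),x(t))$, i.e. $\phi(0,z,x)=x$ and $\frac{d}{dt}\phi(t,z,x)=F(\xi(t,z),\phi(t,z,x))$ for all $t\in\mathbb{R}$. For $f:X\to\mathbb{R}$ put $$\mathcal{P}^{(t)}_z f(x)=f\big(\phi(-t,\xi(t,z),x)\big)\,\big|\det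 D\phi(-t,\xi(t,z),x)\big| ,$$ where $D$ is the derivative in $x$ and the determinant is taken in orthonormal bases of the tangent spaces. Let $\{B_1,\dots,B_n\}$ be a partition of $X$ into connected Borel sets of positive measure and let $\pi_n f=\sum_{i=1}^n \frac{\int_{B_i}f\,dm}{m(B_i)}\chi_{B_i}$. For $T>0$ let $P^{(T)}(z)$ be the $n\times n$ matrix, acting on column vectors, of $\pi_n\mathcal{P}_z^{(T)}$ restricted to $\mathrm{span}\{\chi_{B_1},\dots,\chi_{B_n}\}$ in the basis $\chi_{B_1},\dots,\chi_{B_n}$. Let $\Psi^{(T)}(z)=\big(P^{(T)}(z)^\top P^{(T)}(z)\big)^{1/2T}$, and let $U_2^{(T)}(z)\subset\mathbb{R}^n$ be the eigenspace of $\Psi^{(T)}(z)$ for its second largest eigenvalue (distinct eigenvalues counted once). Fix $T>0$, $N\ge 0$ and $z\in\Xi$, and suppose that $U_2^{(T)}(\xi(-N,z))$ is one-dimensional. For $y\in\Xi$ let $f_{n,y,T}=\sum_{i=1}^n (u_2^{(T)}(y))_i\,\chi_{B_i}$, where $y\mapsto u_2^{(T)}(y)\in\mathbb{R}^n$ is any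 choice of vectors such that, at $y=\xi(-N,z)$, $u_2^{(T)}(y)\in U_2^{(T)}(y)$ and $\|f_{n,y,T}\|_{L^1(m)}=1$. For $w\in\Xi$ and $N'\in\mathbb{R}$ define $$\hat f_{n,w,T,N'}=\pi_n\,\mathcal{P}^{(N')}_{\xi(-N',w)}\,f_{n,\xi(-N',w),T}.$$ **Proposition.** The functions $\mathcal{P}^{(t)}_{\xi(-N,z)}f_{n,\xi(-N,z),T}$, $t\in\mathbb{R}$, belong to $L^1(X,m)$, and $$\big\|\hat f_{n,\xi(\delta,z),T,N+\delta}-\hat f_{n,z,T,N}\big\|_{L^1(m)}\longrightarrow 0\qquad\text{as }\delta\to 0 .$$ -/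

import Mathlib

open scoped Manifold ContDiff Topology Matrix

noncomputable section

namespace OseledetsUlam

/-! ### The manifold and its normalised Lebesgue measure

The compact manifold `X` of dimension `d` (possibly with boundary or corners, according to the
model `I`) sits in `ℝ^D` through `ι`. -/

section Manifold

variable {d D : ℕ} {H : Type*} [TopologicalSpace H]
  (I : ModelWithCorners ℝ (EuclideanSpace ℝ (Fin d)) H)
  {X : Type*} [TopologicalSpace X] [ChartedSpace H X]

/-- The derivative at `x` of a map `X → ℝ^D`, with `T_x X = ℝ^d` (coordinates of the preferred chart
at `x`). -/
def ambientDeriv (f : X → EuclideanSpace ℝ (Fin D)) (x : X) :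
    EuclideanSpace ℝ (Fin d) →L[ℝ] EuclideanSpace ℝ (Fin D) :=
  mfderiv I 𝓘(ℝ, EuclideanSpace ℝ (Fin D)) f x

/-- The derivative at `x` of a map `Φ : X → X`, with `T_x X = ℝ^d = T_{Φ x} X` (coordinates of the
preferred charts at `x` and at `Φ x`). -/
def selfDeriv (Φ : X → X) (x : X) : EuclideanSpace ℝ (Fin d) →L[ℝ] EuclideanSpace ℝ (Fin d) :=
  mfderiv I I Φ x

/-- `ι` realises `X` as a smooth submanifold of `ℝ^D`: it is a smooth injective immersion (for
compact `X` it is then automatically a topological embedding). -/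
structure IsSubmanifoldInclusion (ι : X → EuclideanSpace ℝ (Fin D)) : Prop where
  smooth : ContMDiff I 𝓘(ℝ, EuclideanSpace ℝ (Fin D)) ∞ ι
  injective : Function.Injective ι
  immersion : ∀ x : X, Function.Injective (ambientDeriv I ι x)

/-- The `d`-dimensional Lebesgue (surface) measure on `X ⊆ ℝ^D`, that is, `d`-dimensional Hausdorff
measure of `ℝ^D` on `ι(X)`, normalised to total mass one. -/
def lebesgue (d : ℕ) [MeasurableSpace X] (ι : X → EuclideanSpace ℝ (Fin D)) :
    MeasureTheory.Measure X :=
  ((MeasureTheory.Measure.euclideanHausdorffMeasure d).comap ι Set.univ)⁻¹ •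
    (MeasureTheory.Measure.euclideanHausdorffMeasure d).comap ι

/-- The `d`-dimensional volume factor of the inclusion `ι` at `x`, in the coordinates of the
tangent space `T_x X = ℝ^d`: the square root of the Gram determinant of `Dι(x)`. -/
def volumeFactor (ι : X → EuclideanSpace ℝ (Fin D)) (x : X) : ℝ :=
  LinearMap.normDet (ambientDeriv I ι x).toLinearMap

/-- `|det DΦ(x)|` for a map `Φ : X → X`. The determinant is the one of
`DΦ(x) : T_x X → T_{Φ x} X` in orthonormal bases of the two tangent spaces (with the inner products
of `ℝ^D`); the quotient of volume factors passes to such bases from the coordinates in which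
`T_x X = ℝ^d = T_{Φ x} X`. -/
def absDet (ι : X → EuclideanSpace ℝ (Fin D)) (Φ : X → X) (x : X) : ℝ :=
  |LinearMap.det (selfDeriv I Φ x).toLinearMap| * volumeFactor I ι (Φ x) / volumeFactor I ι x

/-! ### The nonautonomous flow -/

/-- `ξ` is a flow on the set `Ξ` of generalised times. -/
structure IsDrivingFlow {Ξ : Type*} (ξ : ℝ → Ξ → Ξ) : Prop where
  zero : ∀ z, ξ 0 z = z
  add : ∀ s t z, ξ (s + t) z = ξ s (ξ t z)

/-- The vector field `F(z, ·)`, seen as a map `X → ℝ^D`. -/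
def ambientField {Ξ : Type*} (ι : X → EuclideanSpace ℝ (Fin D))
    (F : Ξ → (x : X) → TangentSpace I x) (z : Ξ) (x : X) : EuclideanSpace ℝ (Fin D) :=
  ambientDeriv I ι x (F z x)

/-- Regularity of the vector field: each `F(z, ·)` is `C¹` on `X`, and along each orbit of `ξ` the
`C¹` norm of `F(ξ(t, z), ·)` is bounded by a locally integrable function of `t`, i.e.
`(t, x) ↦ F(ξ(t, z), x)` is of class `L¹_loc(ℝ, C¹)`. This includes every field for which
`F(ξ(t, z), x)` and its `x`-derivative are continuous in `(t, x)`. -/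
structure IsRegularField {Ξ : Type*} (ι : X → EuclideanSpace ℝ (Fin D)) (ξ : ℝ → Ξ → Ξ)
    (F : Ξ → (x : X) → TangentSpace I x) : Prop where
  contMDiff : ∀ z, ContMDiff I 𝓘(ℝ, EuclideanSpace ℝ (Fin D)) 1 (ambientField I ι F z)
  bound : ∀ z, ∃ k : ℝ → ℝ, MeasureTheory.LocallyIntegrable k MeasureTheory.volume ∧
    ∀ t x, ‖ambientField I ι F (ξ t z) x‖ ≤ k t ∧
      ∀ v : EuclideanSpace ℝ (Fin d),
        ‖ambientDeriv I (ambientField I ι F (ξ t z)) x v‖ ≤ k t * ‖ambientDeriv I ι x v‖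

/-- `φ` is the flow of `ẋ(t) = F(ξ(t, z), x(t))`: `φ(0, z, x) = x` and
`d/dt φ(t, z, x) = F(ξ(t, z), φ(t, z, x))` for all `t ∈ ℝ` (classical solutions). -/
structure IsFlowOf {Ξ : Type*} (ξ : ℝ → Ξ → Ξ) (F : Ξ → (x : X) → TangentSpace I x)
    (φ : ℝ → Ξ → X → X) : Prop where
  zero : ∀ z x, φ 0 z x = x
  deriv : ∀ z x t, HasMFDerivAt 𝓘(ℝ, ℝ) I (fun s => φ s z x) t
    ((1 : ℝ →L[ℝ] ℝ).smulRight (F (ξ t z) (φ t z x)))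

/-! ### Perron–Frobenius operators, Ulam projection and Oseledets functions -/

/-- `𝒫_z^{(t)} f (x) = f(φ(-t, ξ(t, z), x)) · |det Dφ(-t, ξ(t, z), x)|`. -/
def perronFrobenius {Ξ : Type*} (ι : X → EuclideanSpace ℝ (Fin D)) (ξ : ℝ → Ξ → Ξ)
    (φ : ℝ → Ξ → X → X) (z : Ξ) (t : ℝ) (f : X → ℝ) (x : X) : ℝ :=
  f (φ (-t) (ξ t z) x) * absDet I ι (φ (-t) (ξ t z)) x

/-- `B₁, …, Bₙ` is a partition of `X` into connected (Borel) sets of positive measure. -/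
structure IsUlamPartition [MeasurableSpace X] (m : MeasureTheory.Measure X) {n : ℕ}
    (B : Fin n → Set X) : Prop where
  measurable : ∀ i, MeasurableSet (B i)
  connected : ∀ i, IsConnected (B i)
  pos : ∀ i, 0 < m (B i)
  disjoint : ∀ i j, i ≠ j → Disjoint (B i) (B j)
  cover : ⋃ i, B i = Set.univ

/-- The function `∑ i, u i • χ_{B i}`. -/
def stepFunction {n : ℕ} (B : Fin n → Set X) (u : Fin n → ℝ) (x : X) : ℝ :=
  ∑ i, u i * (B i).indicator 1 x

/-- The coefficients `(∫_{B i} f dm) / m(B i)` of the Ulam projection of `f`. -/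
def ulamCoeff [MeasurableSpace X] (m : MeasureTheory.Measure X) {n : ℕ} (B : Fin n → Set X)
    (f : X → ℝ) (i : Fin n) : ℝ :=
  (∫ x in B i, f x ∂m) / m.real (B i)

/-- The Ulam projection `π_n f = ∑ i, ((∫_{B i} f dm) / m(B i)) χ_{B i}`. -/
def ulamProj [MeasurableSpace X] (m : MeasureTheory.Measure X) {n : ℕ} (B : Fin n → Set X)
    (f : X → ℝ) : X → ℝ :=
  stepFunction B (ulamCoeff m B f)

/-- The matrix `P^{(T)}(z)` of the restriction of `π_n 𝒫_z^{(T)}` to `span {χ_{B₁}, …, χ_{Bₙ}}`, in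
the basis `χ_{B₁}, …, χ_{Bₙ}` and acting on column vectors. -/
def ulamMatrix [MeasurableSpace X] {Ξ : Type*} (ι : X → EuclideanSpace ℝ (Fin D)) (ξ : ℝ → Ξ → Ξ)
    (φ : ℝ → Ξ → X → X) {n : ℕ} (B : Fin n → Set X) (T : ℝ) (z : Ξ) : Matrix (Fin n) (Fin n) ℝ :=
  Matrix.of fun i j =>
    ulamCoeff (lebesgue d ι) B (perronFrobenius I ι ξ φ z T ((B j).indicator 1)) i

/-- `Ψ^{(T)}(z) = (P^{(T)}(z)ᵀ P^{(T)}(z))^{1/(2T)}`, the power being the one of positive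
semidefinite matrices (functional calculus). -/
def psiMatrix [MeasurableSpace X] {Ξ : Type*} (ι : X → EuclideanSpace ℝ (Fin D)) (ξ : ℝ → Ξ → Ξ)
    (φ : ℝ → Ξ → X → X) {n : ℕ} (B : Fin n → Set X) (T : ℝ) (z : Ξ) : Matrix (Fin n) (Fin n) ℝ :=
  cfc (fun s : ℝ => s ^ (1 / (2 * T)))
    ((ulamMatrix I ι ξ φ B T z)ᵀ * ulamMatrix I ι ξ φ B T z)

end Manifold

/-- The eigenspace of the real matrix `A` for its `j`-th largest real eigenvalue, distinct
eigenvalues being counted once and `j = 1` giving the largest one; it is `⊥` if `A` has fewer than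
`j` eigenvalues. -/
def rankedEigenspace {n : ℕ} (A : Matrix (Fin n) (Fin n) ℝ) (j : ℕ) : Submodule ℝ (Fin n → ℝ) :=
  ⨆ μ ∈ {μ : ℝ | Module.End.HasEigenvalue (Matrix.toLin' A) μ ∧
      {ν : ℝ | μ < ν ∧ Module.End.HasEigenvalue (Matrix.toLin' A) ν}.ncard + 1 = j},
    Module.End.eigenspace (Matrix.toLin' A) μ

section Oseledets

variable {d D : ℕ} {H : Type*} [TopologicalSpace H]
  (I : ModelWithCorners ℝ (EuclideanSpace ℝ (Fin d)) H)
  {X : Type*} [TopologicalSpace X] [ChartedSpace H X]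

/-- `U_j^{(T)}(z)`: the `j`-th eigenspace of `Ψ^{(T)}(z)`, eigenvalues in decreasing order. -/
def singularSpace [MeasurableSpace X] {Ξ : Type*} (ι : X → EuclideanSpace ℝ (Fin D))
    (ξ : ℝ → Ξ → Ξ) (φ : ℝ → Ξ → X → X) {n : ℕ} (B : Fin n → Set X) (T : ℝ) (z : Ξ) (j : ℕ) :
    Submodule ℝ (Fin n → ℝ) :=
  rankedEigenspace (psiMatrix I ι ξ φ B T z) j

/-- The approximate Oseledets function
`f̂_{n,z,T,N} = π_n 𝒫^{(N)}_{ξ(-N,z)} f_{n,ξ(-N,z),T}`, where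
`f_{n,y,T} = ∑ i, (u y) i • χ_{B i}` and `u y` is the chosen vector of `U₂^{(T)}(y)`. -/
def oseledetsApprox [MeasurableSpace X] {Ξ : Type*} (ι : X → EuclideanSpace ℝ (Fin D))
    (ξ : ℝ → Ξ → Ξ) (φ : ℝ → Ξ → X → X) {n : ℕ} (B : Fin n → Set X) (u : Ξ → Fin n → ℝ)
    (z : Ξ) (N : ℝ) : X → ℝ :=
  ulamProj (lebesgue d ι) B
    (perronFrobenius I ι ξ φ (ξ (-N) z) N (stepFunction B (u (ξ (-N) z))))

end Oseledets

end OseledetsUlam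

end

open OseledetsUlam

/-! The base point does not move with `δ`: `ξ (-(N + δ)) (ξ δ z) = ξ (-N) z`. Hence both
approximants are Ulam projections of one fixed step function `f` transported for the times `N + δ`
and `N`. They are step functions on one partition, so it suffices that each integral of `𝒫^{(t)} f`
over `B i` is continuous in `t` (`IsFlowOf.tendsto_setIntegral_perronFrobenius`).

By duality the integral of `𝒫^{(t)} f` over `A` is the integral of `χ_A(φ_t x) f(x)`. The boundary
of `A` may have positive measure, so `χ_A ∘ φ_t` need not converge almost everywhere. Instead `χ_A`
is approximated in `L¹` by a bounded continuous `g`: dominated convergence handles `g ∘ φ_t`, and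
the error is uniform in `t` because `m.map φ_t ≤ C • m` for `t` near `t₀`
(`tendsto_integral_indicator_comp_mul`).

Both the duality and this bound use only that `φ_t` and its inverse are Lipschitz, which follows
from a Gronwall estimate with locally integrable coefficient; the flow is never shown to be
differentiable everywhere. Rademacher's theorem gives differentiability almost everywhere, Lipschitz
maps preserve null sets, and the area formula then yields the change of variables
(`IsSubmanifoldInclusion.map_withDensity_absDet`). -/

section Auxiliary

open MeasureTheory Set Filter
open scoped NNReal ENNReal

namespace OseledetsUlam

/-! ### The area formula for the Euclidean Hausdorff measure -/

/-- If distances in the image of `f` are controlled by distances in the image of `g`, then so are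
the Hausdorff measures of the images. -/
theorem euclideanHausdorffMeasure_image_le_of_dist_le {α Y Z : Type*}
    [MetricSpace Y] [MeasurableSpace Y] [BorelSpace Y]
    [MetricSpace Z] [MeasurableSpace Z] [BorelSpace Z] (d : ℕ) {K : ℝ≥0} {f : α → Y} {g : α → Z}
    {S : Set α} (h : ∀ x ∈ S, ∀ y ∈ S, dist (f x) (f y) ≤ K * dist (g x) (g y)) :
    μHE[d] (f '' S) ≤ (K : ℝ≥0∞) ^ d * μHE[d] (g '' S) := by
  rcases isEmpty_or_nonempty α with hα | hα
  · simp [Set.eq_empty_of_isEmpty S]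
  -- `g` need not be injective on `S`, but the bound forces `f x = f y` whenever `g x = g y`. So `f`
  -- factors through `g` by any choice of preimages, and the factor is `K`-Lipschitz.
  have hmem : ∀ x ∈ S, Function.invFunOn g S (g x) ∈ S ∧ g (Function.invFunOn g S (g x)) = g x :=
    fun x hx => ⟨Function.invFunOn_mem ⟨x, hx, rfl⟩, Function.invFunOn_eq ⟨x, hx, rfl⟩⟩
  have hfx : ∀ x ∈ S, f (Function.invFunOn g S (g x)) = f x := by
    intro x hx
    have := h _ (hmem x hx).1 x hx
    rw [(hmem x hx).2, dist_self, mul_zero] at this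
    exact dist_le_zero.1 this
  have himg : f '' S = (fun p => f (Function.invFunOn g S p)) '' (g '' S) := by
    rw [image_image]
    exact image_congr fun x hx => (hfx x hx).symm
  have hlip : LipschitzOnWith K (fun p => f (Function.invFunOn g S p)) (g '' S) := by
    refine LipschitzOnWith.of_dist_le_mul ?_
    rintro _ ⟨x, hx, rfl⟩ _ ⟨y, hy, rfl⟩
    simp only [hfx x hx, hfx y hy]
    exact h x hx y hy
  have := hlip.hausdorffMeasure_image_le (d := d) (by positivity)
  rw [← himg, ENNReal.rpow_natCast] at this
  simp only [Measure.euclideanHausdorffMeasure_def, Measure.smul_apply,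
    Measure.nnreal_smul_coe_apply]
  calc _ ≤ _ := mul_le_mul_right this _
    _ = _ := mul_left_comm _ _ _

theorem euclideanHausdorffMeasure_image_continuousLinearMap {d D : ℕ}
    (A : EuclideanSpace ℝ (Fin d) →L[ℝ] EuclideanSpace ℝ (Fin D))
    (s : Set (EuclideanSpace ℝ (Fin d))) :
    μHE[d] (A '' s) = ENNReal.ofReal A.toLinearMap.normDet * volume s := by
  simpa using A.toLinearMap.euclideanHausdorffMeasure_image_eq_normDet_mul_volume s

/-- Compare the Hausdorff measures of the images of the unit ball under `A` and `B`, then cancel the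
volume of the ball. -/
theorem normDet_le_of_norm_le {d D : ℕ}
    {A B : EuclideanSpace ℝ (Fin d) →L[ℝ] EuclideanSpace ℝ (Fin D)} {c : ℝ≥0}
    (h : ∀ v, ‖A v‖ ≤ c * ‖B v‖) :
    ENNReal.ofReal A.toLinearMap.normDet ≤ (c : ℝ≥0∞) ^ d *
      ENNReal.ofReal B.toLinearMap.normDet := by
  have := euclideanHausdorffMeasure_image_le_of_dist_le d (f := A) (g := B) (K := c)
    (S := Metric.ball 0 1) (fun x _ y _ => by
      rw [dist_eq_norm, dist_eq_norm, ← map_sub, ← map_sub]; exact h _)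
  rw [euclideanHausdorffMeasure_image_continuousLinearMap,
    euclideanHausdorffMeasure_image_continuousLinearMap, ← mul_assoc] at this
  exact (ENNReal.mul_le_mul_iff_left (Metric.measure_ball_pos volume _ one_pos).ne'
    (measure_ball_lt_top).ne).1 this

/-- If `‖v‖ ≤ a ‖A v‖`, the radius `(c - 1) / (c (D + 1) a)` gives `c ‖u - A v‖ ≤ (c - 1) ‖A v‖`,
and both bounds follow from the triangle inequality. The factor `D + 1` absorbs the loss in
`ae_norm_fderivWithin_sub_le`. A nonzero radius is supplied for non-injective `A` too, since the
partition into nearly linear pieces asks for one at every `A`. -/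
theorem exists_radius_norm_le {d D : ℕ}
    (A : EuclideanSpace ℝ (Fin d) →L[ℝ] EuclideanSpace ℝ (Fin D)) {c : ℝ≥0} (hc : 1 < c) :
    ∃ r : ℝ≥0, r ≠ 0 ∧ (Function.Injective A → ∀ v u, ‖u - A v‖ ≤ (D + 1) * r * ‖v‖ →
      ‖u‖ ≤ c * ‖A v‖ ∧ ‖A v‖ ≤ c * ‖u‖) := by
  by_cases hA : Function.Injective A
  · obtain ⟨a, ha, hA'⟩ := A.toLinearMap.exists_antilipschitzWith (LinearMap.ker_eq_bot.2 hA)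
    have hc0 : (0 : ℝ≥0) < c := zero_lt_one.trans hc
    have hc' : (1 : ℝ) < c := by exact_mod_cast hc
    refine ⟨(c - 1) / (c * ((D + 1) * a)), ?_, fun _ v u huv => ?_⟩
    · exact (div_pos (tsub_pos_of_lt hc) (by positivity)).ne'
    · have hv : ‖v‖ ≤ a * ‖A v‖ := by
        simpa using hA'.le_mul_dist v 0
      have ha' : (0 : ℝ) < a := by exact_mod_cast ha
      have hcr : (0 : ℝ) < c := by exact_mod_cast hc0
      have key : c * ‖u - A v‖ ≤ (c - 1) * ‖A v‖ := by
        rw [NNReal.coe_div, NNReal.coe_sub hc.le] at huv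
        push_cast at huv
        calc c * ‖u - A v‖ ≤ c * ((D + 1) * ((c - 1) / (c * ((D + 1) * a))) * ‖v‖) := by gcongr
          _ = (c - 1) / a * ‖v‖ := by field_simp
          _ ≤ (c - 1) / a * (a * ‖A v‖) := by
            have : (0 : ℝ) ≤ (c - 1) / a := div_nonneg (by linarith) ha'.le
            gcongr
          _ = (c - 1) * ‖A v‖ := by field_simp
      have h1 : ‖A v‖ ≤ ‖u‖ + ‖u - A v‖ := by
        calc ‖A v‖ = ‖u - (u - A v)‖ := by simp
          _ ≤ _ := norm_sub_le _ _
      have h2 : ‖u‖ ≤ ‖A v‖ + ‖u - A v‖ := by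
        calc ‖u‖ = ‖A v + (u - A v)‖ := by simp
          _ ≤ _ := norm_add_le _ _
      have h3 : ‖u - A v‖ ≤ c * ‖u - A v‖ := by nlinarith [norm_nonneg (u - A v)]
      constructor
      · nlinarith
      · nlinarith
  · exact ⟨1, one_ne_zero, fun h => absurd h hA⟩

/-- The rank one map `w ↦ wᵢ • e`. -/
noncomputable def coordSMul {d D : ℕ} (e : EuclideanSpace ℝ (Fin d)) (i : Fin D) :
    EuclideanSpace ℝ (Fin D) →L[ℝ] EuclideanSpace ℝ (Fin d) :=
  (EuclideanSpace.proj i : EuclideanSpace ℝ (Fin D) →L[ℝ] ℝ).smulRight e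

theorem coordSMul_apply {d D : ℕ} (e : EuclideanSpace ℝ (Fin d)) (i : Fin D)
    (w : EuclideanSpace ℝ (Fin D)) : coordSMul e i w = w i • e := rfl

theorem norm_le_sum_abs {D : ℕ} (w : EuclideanSpace ℝ (Fin D)) : ‖w‖ ≤ ∑ i, |w i| := by
  calc ‖w‖ = ‖∑ i, w i • EuclideanSpace.single i (1 : ℝ)‖ := by
        congr 1; ext j; simp [Finset.sum_apply, Pi.single_apply]
    _ ≤ ∑ i, ‖w i • EuclideanSpace.single i (1 : ℝ)‖ := norm_sum_le _ _
    _ = _ := by simp [norm_smul]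

/-- The estimate for self-maps of `ℝ^d` is applied to each coordinate, turned into the self-map `x ↦
(f x)ᵢ • e` with `e` a unit vector. Summing over coordinates costs a factor `D`; `D + 1` stays
positive when `D = 0`. -/
theorem ae_norm_fderivWithin_sub_le {d D : ℕ}
    {f : EuclideanSpace ℝ (Fin d) → EuclideanSpace ℝ (Fin D)} {s : Set (EuclideanSpace ℝ (Fin d))}
    {A : EuclideanSpace ℝ (Fin d) →L[ℝ] EuclideanSpace ℝ (Fin D)} {δ : ℝ≥0}
    (hf : ApproximatesLinearOn f A s δ) (hs : MeasurableSet s)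
    (f' : EuclideanSpace ℝ (Fin d) → EuclideanSpace ℝ (Fin d) →L[ℝ] EuclideanSpace ℝ (Fin D))
    (hf' : ∀ x ∈ s, HasFDerivWithinAt f (f' x) s x) :
    ∀ᵐ x ∂volume.restrict s, ∀ v, ‖f' x v - A v‖ ≤ (D + 1) * δ * ‖v‖ := by
  rcases subsingleton_or_nontrivial (EuclideanSpace ℝ (Fin d)) with h | h
  · refine Filter.Eventually.of_forall fun x v => ?_
    rw [Subsingleton.elim v 0]; simp
  obtain ⟨e, he⟩ := exists_norm_eq (EuclideanSpace ℝ (Fin d)) zero_le_one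
  have key : ∀ i : Fin D, ∀ᵐ x ∂volume.restrict s,
      ‖(coordSMul e i ∘L f' x) - (coordSMul e i ∘L A)‖₊ ≤ δ := by
    intro i
    refine ApproximatesLinearOn.norm_fderiv_sub_le (f := fun x => coordSMul e i (f x)) volume ?_ hs
      (fun x => coordSMul e i ∘L f' x) (fun x hx => ?_)
    · intro x hx y hy
      refine le_trans ?_ (hf x hx y hy)
      have : coordSMul e i (f x) - coordSMul e i (f y) - (coordSMul e i ∘L A) (x - y)
          = coordSMul e i (f x - f y - A (x - y)) := by simp
      rw [this, coordSMul_apply, norm_smul, he, mul_one]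
      exact PiLp.norm_apply_le _ i
    · exact (coordSMul e i).hasFDerivAt.comp_hasFDerivWithinAt x (hf' x hx)
  filter_upwards [ae_all_iff.2 key] with x hx v
  have hi : ∀ i, |(f' x v - A v) i| ≤ δ * ‖v‖ := by
    intro i
    have h1 := ((coordSMul e i ∘L f' x) - (coordSMul e i ∘L A)).le_of_opNorm_le (hx i) v
    have h2 : ((coordSMul e i ∘L f' x) - (coordSMul e i ∘L A)) v
      = ((f' x v - A v) i) • e := by simp [coordSMul_apply, sub_smul]
    rwa [h2, norm_smul, he, mul_one] at h1
  calc ‖f' x v - A v‖ ≤ ∑ i, |(f' x v - A v) i| := norm_le_sum_abs _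
    _ ≤ ∑ i : Fin D, δ * ‖v‖ := Finset.sum_le_sum fun i _ => hi i
    _ = D * (δ * ‖v‖) := by simp
    _ ≤ (D + 1) * δ * ‖v‖ := by
      have : (0 : ℝ) ≤ δ * ‖v‖ := by positivity
      nlinarith

/-- The volume factor is the square root of a Gram determinant, a polynomial in the entries of `f'
x`; each entry is measurable by the same passage to self-maps `x ↦ (f x)ᵢ • e`. -/
theorem aemeasurable_normDet_fderivWithin {d D : ℕ}
    {f : EuclideanSpace ℝ (Fin d) → EuclideanSpace ℝ (Fin D)} {s : Set (EuclideanSpace ℝ (Fin d))}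
    (hs : MeasurableSet s)
    (f' : EuclideanSpace ℝ (Fin d) → EuclideanSpace ℝ (Fin d) →L[ℝ] EuclideanSpace ℝ (Fin D))
    (hf' : ∀ x ∈ s, HasFDerivWithinAt f (f' x) s x) :
    AEMeasurable (fun x => (f' x).toLinearMap.normDet) (volume.restrict s) := by
  rcases subsingleton_or_nontrivial (EuclideanSpace ℝ (Fin d)) with h | h
  · simp only [LinearMap.normDet_of_subsingleton]
    exact aemeasurable_const
  obtain ⟨e, he⟩ := exists_norm_eq (EuclideanSpace ℝ (Fin d)) zero_le_one
  have key : ∀ (v : EuclideanSpace ℝ (Fin d)) (i : Fin D),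
      AEMeasurable (fun x => f' x v i) (volume.restrict s) := by
    intro v i
    have h1 := aemeasurable_fderivWithin (f := fun x => coordSMul e i (f x)) volume hs
      (f' := fun x => coordSMul e i ∘L f' x)
      (fun x hx => (coordSMul e i).hasFDerivAt.comp_hasFDerivWithinAt x (hf' x hx))
    have h2 : Measurable fun B : EuclideanSpace ℝ (Fin d) →L[ℝ] EuclideanSpace ℝ (Fin d) =>
        inner ℝ e (B v) := by
      apply Continuous.measurable; fun_prop
    refine (h2.comp_aemeasurable h1).congr (Filter.Eventually.of_forall fun x => ?_)
    simp [coordSMul_apply, inner_smul_right, he]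
  have hsq : ∀ x, (f' x).toLinearMap.normDet = √((Matrix.of fun j k =>
      ∑ i, f' x (EuclideanSpace.basisFun (Fin d) ℝ k) i *
        f' x (EuclideanSpace.basisFun (Fin d) ℝ j) i).det) := by
    intro x
    have := (f' x).toLinearMap.normDet_sq_eq_det_gram (EuclideanSpace.basisFun (Fin d) ℝ)
    rw [← Real.sqrt_sq (f' x).toLinearMap.normDet_nonneg]
    exact congrArg _ this
  simp only [hsq]
  refine Real.continuous_sqrt.measurable.comp_aemeasurable ?_
  simp only [Matrix.det_apply]
  refine Finset.aemeasurable_fun_sum _ fun σ _ => ?_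
  refine AEMeasurable.const_smul ?_ _
  refine Finset.aemeasurable_fun_prod _ fun j _ => ?_
  simp only [Matrix.of_apply]
  exact Finset.aemeasurable_fun_sum _ fun i _ => (key _ i).mul (key _ i)

/-- The area formula: the `d`-dimensional Hausdorff measure of the image of an injective immersion
of a measurable subset of `ℝ^d` is the integral of its volume factor. -/
theorem euclideanHausdorffMeasure_image_eq_lintegral_normDet {d D : ℕ}
    {f : EuclideanSpace ℝ (Fin d) → EuclideanSpace ℝ (Fin D)} {s : Set (EuclideanSpace ℝ (Fin d))}
    (hs : MeasurableSet s)
    (f' : EuclideanSpace ℝ (Fin d) → EuclideanSpace ℝ (Fin d) →L[ℝ] EuclideanSpace ℝ (Fin D))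
    (hf' : ∀ x ∈ s, HasFDerivWithinAt f (f' x) s x) (hinj : InjOn f s)
    (himm : ∀ x ∈ s, Function.Injective (f' x)) :
    μHE[d] (f '' s) = ∫⁻ x in s, ENNReal.ofReal (f' x).toLinearMap.normDet := by
  rcases s.eq_empty_or_nonempty with rfl | hne
  · simp
  -- On each piece `f` is compared with a linear map `A k`. One factor `c ^ d` comes from replacing
  -- the image under `f` by that under `A k`, the other from replacing the volume factor of `f'` by
  -- that of `A k`. The formula follows as `c → 1`.
  have key : ∀ c : ℝ≥0, 1 < c →
      μHE[d] (f '' s) ≤ ((c : ℝ≥0∞) ^ d * (c : ℝ≥0∞) ^ d) *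
        ∫⁻ x in s, ENNReal.ofReal (f' x).toLinearMap.normDet ∧
      ∫⁻ x in s, ENNReal.ofReal (f' x).toLinearMap.normDet ≤
        ((c : ℝ≥0∞) ^ d * (c : ℝ≥0∞) ^ d) * μHE[d] (f '' s) := by
    intro c hc
    choose r hr0 hr using fun A : EuclideanSpace ℝ (Fin d) →L[ℝ] EuclideanSpace ℝ (Fin D) =>
      exists_radius_norm_le A hc
    obtain ⟨t, A, tdisj, tmeas, tcover, tapprox, tA⟩ :=
      exists_partition_approximatesLinearOn_of_hasFDerivWithinAt f s f' hf' r hr0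
    -- Each `A k` is a value of `f'` on `s`, which is where nonemptiness of `s` is needed.
    have hAinj : ∀ k, Function.Injective (A k) := fun k => by
      obtain ⟨y, hy, hAy⟩ := tA hne k
      rw [hAy]; exact himm y hy
    have hm : ∀ k, MeasurableSet (s ∩ t k) := fun k => hs.inter (tmeas k)
    have hsU : s = ⋃ k, s ∩ t k := by rw [← inter_iUnion, inter_eq_left.2 tcover]
    have hd : Pairwise (Function.onFun Disjoint fun k => s ∩ t k) := fun i j hij =>
      (tdisj hij).mono inter_subset_right inter_subset_right
    have hfm : ∀ k, MeasurableSet (f '' (s ∩ t k)) := fun k =>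
      (hm k).image_of_continuousOn_injOn
        (fun x hx => ((hf' x hx.1).continuousWithinAt.mono inter_subset_left))
        (hinj.mono inter_subset_left)
    have hfd : Pairwise (Function.onFun Disjoint fun k => f '' (s ∩ t k)) := fun i j hij =>
      (hd hij).image hinj inter_subset_left inter_subset_left
    have hL : μHE[d] (f '' s) = ∑' k, μHE[d] (f '' (s ∩ t k)) := by
      conv_lhs => rw [hsU, image_iUnion]
      exact measure_iUnion hfd hfm
    have hR : ∫⁻ x in s, ENNReal.ofReal (f' x).toLinearMap.normDet =
        ∑' k, ∫⁻ x in s ∩ t k, ENNReal.ofReal (f' x).toLinearMap.normDet := by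
      conv_lhs => rw [hsU]
      exact lintegral_iUnion hm hd _
    have hloc : ∀ k, ∀ x ∈ s ∩ t k, ∀ y ∈ s ∩ t k,
        dist (f x) (f y) ≤ c * dist (A k x) (A k y) ∧
        dist (A k x) (A k y) ≤ c * dist (f x) (f y) := by
      intro k x hx y hy
      rw [dist_eq_norm, dist_eq_norm, ← map_sub]
      refine hr (A k) (hAinj k) _ _ ((tapprox k x hx y hy).trans ?_)
      have : (0 : ℝ) ≤ D * (r (A k) * ‖x - y‖) := by positivity
      nlinarith
    have hae : ∀ k, ∀ᵐ x ∂volume.restrict (s ∩ t k), ∀ v,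
        ‖f' x v‖ ≤ c * ‖A k v‖ ∧ ‖A k v‖ ≤ c * ‖f' x v‖ := by
      intro k
      filter_upwards [ae_norm_fderivWithin_sub_le (tapprox k) (hm k) f'
        (fun x hx => (hf' x hx.1).mono inter_subset_left)] with x hx v
      exact hr (A k) (hAinj k) _ _ (hx v)
    have hconst : ∀ k, ENNReal.ofReal (A k).toLinearMap.normDet * volume (s ∩ t k) =
        ∫⁻ x in s ∩ t k, ENNReal.ofReal (A k).toLinearMap.normDet := fun k => by
      rw [setLIntegral_const]
    have hcne : (c : ℝ≥0∞) ^ d ≠ ⊤ := by finiteness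
    rw [hL, hR, ← ENNReal.tsum_mul_left, ← ENNReal.tsum_mul_left]
    refine ⟨ENNReal.tsum_le_tsum fun k => ?_, ENNReal.tsum_le_tsum fun k => ?_⟩
    · refine (euclideanHausdorffMeasure_image_le_of_dist_le d
        (fun x hx y hy => (hloc k x hx y hy).1)).trans ?_
      rw [euclideanHausdorffMeasure_image_continuousLinearMap, hconst, mul_assoc]
      refine mul_le_mul_right ?_ _
      rw [← lintegral_const_mul' _ _ hcne]
      refine lintegral_mono_ae ?_
      filter_upwards [hae k] with x hx
      exact normDet_le_of_norm_le fun v => (hx v).2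
    · have h1 := euclideanHausdorffMeasure_image_le_of_dist_le d
        (fun x hx y hy => (hloc k x hx y hy).2)
      rw [euclideanHausdorffMeasure_image_continuousLinearMap, hconst] at h1
      calc ∫⁻ x in s ∩ t k, ENNReal.ofReal (f' x).toLinearMap.normDet
          ≤ ∫⁻ x in s ∩ t k, (c : ℝ≥0∞) ^ d * ENNReal.ofReal (A k).toLinearMap.normDet := by
            refine lintegral_mono_ae ?_
            filter_upwards [hae k] with x hx
            exact normDet_le_of_norm_le fun v => (hx v).1
        _ = (c : ℝ≥0∞) ^ d * ∫⁻ x in s ∩ t k, ENNReal.ofReal (A k).toLinearMap.normDet :=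
            lintegral_const_mul' _ _ hcne
        _ ≤ (c : ℝ≥0∞) ^ d * ((c : ℝ≥0∞) ^ d * μHE[d] (f '' (s ∩ t k))) := by gcongr
        _ = _ := by rw [mul_assoc]
  have hlim : ∀ b : ℝ≥0∞, Tendsto (fun c : ℝ≥0 => ((c : ℝ≥0∞) ^ d * (c : ℝ≥0∞) ^ d) * b)
      (𝓝[>] 1) (𝓝 b) := by
    intro b
    have h1 : Tendsto (fun c : ℝ≥0 => ((c ^ d * c ^ d : ℝ≥0) : ℝ≥0∞)) (𝓝[>] 1)
        (𝓝 ((1 ^ d * 1 ^ d : ℝ≥0) : ℝ≥0∞)) := by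
      refine ENNReal.tendsto_coe.2 (Tendsto.mono_left ?_ nhdsWithin_le_nhds)
      exact Continuous.tendsto (by fun_prop) 1
    have := ENNReal.Tendsto.mul_const (b := b) h1 (Or.inl (by simp))
    simpa using this
  refine le_antisymm (ge_of_tendsto (hlim _) ?_) (ge_of_tendsto (hlim _) ?_)
  · filter_upwards [self_mem_nhdsWithin] with c hc using (key c hc).1
  · filter_upwards [self_mem_nhdsWithin] with c hc using (key c hc).2

/-! ### A Gronwall inequality with locally integrable coefficient -/

/-- The function `log (‖w‖² + ε)` has derivative bounded by `2 K`, so integrating it from `s` to `t`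
gives the estimate up to `ε`, which then tends to `0`. The shift by `ε` keeps the logarithm
differentiable at zeros of `w`. The order of `s` and `t` plays no role, so the bound also runs
backwards in time. -/
theorem norm_le_exp_integral_mul_norm {F : Type*} [NormedAddCommGroup F] [InnerProductSpace ℝ F]
    [CompleteSpace F] [MeasurableSpace F] [BorelSpace F] [SecondCountableTopology F]
    {w w' : ℝ → F} {K : ℝ → ℝ} (hw : ∀ t, HasDerivAt w (w' t) t) (hK : LocallyIntegrable K)
    (hK0 : ∀ t, 0 ≤ K t) (h : ∀ t, ‖w' t‖ ≤ K t * ‖w t‖) {a b s t : ℝ} (hs : s ∈ Icc a b)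
    (ht : t ∈ Icc a b) :
    ‖w t‖ ≤ Real.exp (∫ x in Icc a b, K x) * ‖w s‖ := by
  have hKab : IntegrableOn K (Icc a b) := hK.integrableOn_isCompact isCompact_Icc
  have hwm : Measurable w' := by
    have : w' = deriv w := funext fun t => (hw t).deriv.symm
    rw [this]; exact measurable_deriv w
  have hwc : Continuous w := continuous_iff_continuousAt.2 fun t => (hw t).continuousAt
  have key : ∀ ε : ℝ, 0 < ε → ‖w t‖ ^ 2 + ε ≤
      Real.exp (2 * ∫ x in Icc a b, K x) * (‖w s‖ ^ 2 + ε) := by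
    intro ε hε
    have hpos : ∀ x, 0 < ‖w x‖ ^ 2 + ε := fun x => by positivity
    have hder : ∀ x, HasDerivAt (fun x => Real.log (‖w x‖ ^ 2 + ε))
        ((2 * inner ℝ (w x) (w' x)) / (‖w x‖ ^ 2 + ε)) x := fun x =>
      (((hw x).norm_sq).add_const ε).log (hpos x).ne'
    have hbd : ∀ x, ‖(2 * inner ℝ (w x) (w' x)) / (‖w x‖ ^ 2 + ε)‖ ≤ 2 * K x := by
      intro x
      rw [norm_div, Real.norm_of_nonneg (hpos x).le, div_le_iff₀ (hpos x), norm_mul,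
        Real.norm_of_nonneg zero_le_two]
      have h1 : ‖inner ℝ (w x) (w' x)‖ ≤ ‖w x‖ * ‖w' x‖ := norm_inner_le_norm _ _
      have h2 : ‖w x‖ * ‖w' x‖ ≤ ‖w x‖ * (K x * ‖w x‖) := by gcongr; exact h x
      nlinarith [mul_nonneg (hK0 x) hε.le]
    have hmeas : Measurable fun x => (2 * inner ℝ (w x) (w' x)) / (‖w x‖ ^ 2 + ε) :=
      ((hwc.measurable.inner hwm).const_mul 2).div
        ((hwc.norm.pow 2).add continuous_const).measurable
    have hsub : uIoc s t ⊆ Icc a b := fun x hx => by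
      rw [uIoc, mem_Ioc] at hx
      exact ⟨(le_min hs.1 ht.1).trans hx.1.le, hx.2.trans (max_le hs.2 ht.2)⟩
    have hdom : IntegrableOn (fun x => 2 * K x) (Icc a b) := hKab.const_mul 2
    have hII : IntervalIntegrable (fun x => (2 * inner ℝ (w x) (w' x)) / (‖w x‖ ^ 2 + ε))
        volume s t := by
      rw [intervalIntegrable_iff]
      exact (hdom.mono_set hsub).mono' hmeas.aestronglyMeasurable
        (Eventually.of_forall hbd)
    have hftc := intervalIntegral.integral_eq_sub_of_hasDerivAt (fun x _ => hder x) hII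
    have hle : Real.log (‖w t‖ ^ 2 + ε) - Real.log (‖w s‖ ^ 2 + ε) ≤
        2 * ∫ x in Icc a b, K x := by
      rw [← hftc]
      calc _ ≤ ‖∫ x in s..t, (2 * inner ℝ (w x) (w' x)) / (‖w x‖ ^ 2 + ε)‖ := le_abs_self _
        _ ≤ ∫ x in uIoc s t, ‖(2 * inner ℝ (w x) (w' x)) / (‖w x‖ ^ 2 + ε)‖ :=
          intervalIntegral.norm_integral_le_integral_norm_uIoc
        _ ≤ ∫ x in uIoc s t, 2 * K x :=
          integral_mono_of_nonneg (Eventually.of_forall fun x => norm_nonneg _)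
            (hdom.mono_set hsub) (Eventually.of_forall hbd)
        _ ≤ ∫ x in Icc a b, 2 * K x :=
          setIntegral_mono_set hdom
            (Eventually.of_forall fun x => mul_nonneg zero_le_two (hK0 x)) hsub.eventuallyLE
        _ = _ := integral_const_mul _ _
    rw [← Real.log_le_log_iff (hpos t) (by have := hpos s; positivity),
      Real.log_mul (Real.exp_pos _).ne' (hpos s).ne', Real.log_exp]
    linarith
  have hsq : ‖w t‖ ^ 2 ≤ (Real.exp (∫ x in Icc a b, K x) * ‖w s‖) ^ 2 := by
    have hexp : Real.exp (2 * ∫ x in Icc a b, K x) = Real.exp (∫ x in Icc a b, K x) ^ 2 := by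
      rw [← Real.exp_nat_mul]; norm_num
    have hlim : Tendsto (fun ε : ℝ => Real.exp (2 * ∫ x in Icc a b, K x) * (‖w s‖ ^ 2 + ε))
        (𝓝[>] 0) (𝓝 (Real.exp (2 * ∫ x in Icc a b, K x) * (‖w s‖ ^ 2 + 0))) :=
      Tendsto.mono_left (Continuous.tendsto (by fun_prop) 0) nhdsWithin_le_nhds
    rw [mul_pow, ← hexp]
    refine ge_of_tendsto (by simpa using hlim) ?_
    filter_upwards [self_mem_nhdsWithin] with ε hε
    have : (0 : ℝ) < ε := hε
    linarith [key ε hε]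
  exact (sq_le_sq₀ (norm_nonneg _) (by positivity)).1 hsq

/-! ### Submanifolds of Euclidean space in charts -/

section Submanifold

variable {d D : ℕ} {H : Type*} [TopologicalSpace H]
  {I : ModelWithCorners ℝ (EuclideanSpace ℝ (Fin d)) H}
  {X : Type*} [TopologicalSpace X] [ChartedSpace H X]
  {ι : X → EuclideanSpace ℝ (Fin D)}

theorem IsSubmanifoldInclusion.isClosedEmbedding [CompactSpace X]
    (hι : IsSubmanifoldInclusion I ι) : Topology.IsClosedEmbedding ι :=
  hι.smooth.continuous.isClosedEmbedding hι.injective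

theorem IsSubmanifoldInclusion.t2Space [CompactSpace X] (hι : IsSubmanifoldInclusion I ι) :
    T2Space X :=
  hι.isClosedEmbedding.isEmbedding.t2Space

theorem IsSubmanifoldInclusion.polishSpace [CompactSpace X] (hι : IsSubmanifoldInclusion I ι) :
    PolishSpace X :=
  hι.isClosedEmbedding.polishSpace

theorem IsSubmanifoldInclusion.measurableEmbedding [CompactSpace X] [MeasurableSpace X]
    [BorelSpace X] (hι : IsSubmanifoldInclusion I ι) : MeasurableEmbedding ι :=
  hι.isClosedEmbedding.measurableEmbedding

theorem IsSubmanifoldInclusion.mdifferentiableAt (hι : IsSubmanifoldInclusion I ι) (x : X) :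
    MDifferentiableAt I 𝓘(ℝ, EuclideanSpace ℝ (Fin D)) ι x :=
  hι.smooth.mdifferentiableAt (by simp)

theorem IsSubmanifoldInclusion.continuous_of_dist_le [CompactSpace X]
    (hι : IsSubmanifoldInclusion I ι)
    {Ψ : X → X} {K : ℝ≥0} (hΨ : ∀ x y, dist (ι (Ψ x)) (ι (Ψ y)) ≤ K * dist (ι x) (ι y)) :
    Continuous Ψ := by
  rw [hι.isClosedEmbedding.isEmbedding.continuous_iff, continuous_iff_continuousAt]
  intro x
  refine tendsto_iff_dist_tendsto_zero.2 (squeeze_zero (fun _ => dist_nonneg) (fun y => hΨ y x) ?_)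
  have h : Tendsto (fun y => K * dist (ι y) (ι x)) (𝓝 x) (𝓝 (K * dist (ι x) (ι x))) :=
    Continuous.tendsto (continuous_const.mul (hι.smooth.continuous.dist continuous_const)) x
  simpa using h

variable (I) in
/-- The derivative at `p` of the inverse of the chart at `x₀`. -/
noncomputable def chartInvDeriv (x₀ : X) (p : EuclideanSpace ℝ (Fin d)) :
    EuclideanSpace ℝ (Fin d) →L[ℝ] EuclideanSpace ℝ (Fin d) :=
  mfderivWithin 𝓘(ℝ, EuclideanSpace ℝ (Fin d)) I (extChartAt I x₀).symm (range I) p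

variable [IsManifold I ∞ X]

theorem isInvertible_chartInvDeriv {x₀ : X} {p : EuclideanSpace ℝ (Fin d)}
    (hp : p ∈ (extChartAt I x₀).target) : (chartInvDeriv I x₀ p).IsInvertible := by
  have : IsManifold I 1 X := IsManifold.of_le (n := ∞) (by simp)
  exact isInvertible_mfderivWithin_extChartAt_symm hp

theorem hasFDerivWithinAt_comp_extChartAt_symm {f : X → EuclideanSpace ℝ (Fin D)} {x₀ : X}
    {p : EuclideanSpace ℝ (Fin d)} (hp : p ∈ (extChartAt I x₀).target)
    (hf : MDifferentiableAt I 𝓘(ℝ, EuclideanSpace ℝ (Fin D)) f ((extChartAt I x₀).symm p)) :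
    HasFDerivWithinAt (f ∘ (extChartAt I x₀).symm)
      (ambientDeriv I f ((extChartAt I x₀).symm p) ∘L chartInvDeriv I x₀ p) (range I) p := by
  have : IsManifold I 1 X := IsManifold.of_le (n := ∞) (by simp)
  exact (hf.hasMFDerivAt.comp_hasMFDerivWithinAt p
    (mdifferentiableWithinAt_extChartAt_symm hp).hasMFDerivWithinAt).hasFDerivWithinAt

/-- In a chart, a submanifold inclusion is close to its derivative on a convex neighbourhood. -/
theorem IsSubmanifoldInclusion.exists_approximatesLinearOn (hι : IsSubmanifoldInclusion I ι)
    (x₀ : X) {c : ℝ≥0} (hc : 0 < c) :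
    ∃ t ∈ 𝓝[range I] (extChartAt I x₀ x₀), t ⊆ (extChartAt I x₀).target ∧ Convex ℝ t ∧
      (∀ p ∈ t, ‖(ambientDeriv I ι ((extChartAt I x₀).symm p) ∘L chartInvDeriv I x₀ p) -
        (ambientDeriv I ι x₀ ∘L chartInvDeriv I x₀ (extChartAt I x₀ x₀))‖ ≤ c) ∧
      ApproximatesLinearOn (ι ∘ (extChartAt I x₀).symm)
        (ambientDeriv I ι x₀ ∘L chartInvDeriv I x₀ (extChartAt I x₀ x₀)) t c := by
  have hM : IsManifold I 1 X := IsManifold.of_le (n := ∞) (by simp)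
  set e := extChartAt I x₀ with he
  set h : EuclideanSpace ℝ (Fin d) → EuclideanSpace ℝ (Fin D) := ι ∘ e.symm with hh
  set h' : EuclideanSpace ℝ (Fin d) → EuclideanSpace ℝ (Fin d) →L[ℝ] EuclideanSpace ℝ (Fin D) :=
    fun p => ambientDeriv I ι (e.symm p) ∘L chartInvDeriv I x₀ p with hh'
  have hder : ∀ p ∈ e.target, HasFDerivWithinAt h (h' p) (range I) p := fun p hp =>
    hasFDerivWithinAt_comp_extChartAt_symm hp (hι.mdifferentiableAt _)
  have hsm : ContDiffWithinAt ℝ 1 h (range I) (e x₀) := by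
    have h1 := (hι.smooth x₀).of_le (show (1 : ℕ∞ω) ≤ _ by simp)
    have h2 := (contMDiffAt_iff.1 h1).2
    simpa only [extChartAt_model_space_eq_id, PartialEquiv.refl_coe, Function.id_comp] using h2
  have hcont : ContinuousWithinAt h' (range I) (e x₀) := by
    have h1 : ContinuousWithinAt (fderivWithin ℝ h (range I)) (range I) (e x₀) :=
      (hsm.fderivWithin_right (m := 0) I.uniqueDiffOn (by simp)
        (mem_range_self _)).continuousWithinAt
    -- Derivatives within `range I` are unique, even at boundary and corner points, so `h'` is
    -- `fderivWithin` on the chart target.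
    refine h1.congr_of_eventuallyEq ?_ ?_
    · filter_upwards [extChartAt_target_mem_nhdsWithin x₀] with p hp
      exact ((hder p hp).fderivWithin
        (I.uniqueDiffOn _ (extChartAt_target_subset_range x₀ hp))).symm
    · exact ((hder _ (mem_extChartAt_target x₀)).fderivWithin
        (I.uniqueDiffOn _ (mem_range_self _))).symm
  have hnear : ∀ᶠ p in 𝓝[range I] (e x₀), p ∈ e.target ∧ ‖h' p - h' (e x₀)‖ ≤ c := by
    refine Filter.Eventually.and (extChartAt_target_mem_nhdsWithin x₀) ?_
    have := hcont.eventually (Metric.closedBall_mem_nhds (h' (e x₀)) (by exact_mod_cast hc))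
    filter_upwards [this] with p hp
    rwa [← dist_eq_norm]
  obtain ⟨ρ, hρ, hsub⟩ := Metric.mem_nhdsWithin_iff.1 hnear
  have hxx : h' (e x₀) = ambientDeriv I ι x₀ ∘L chartInvDeriv I x₀ (e x₀) := by
    simp [hh', he]
  -- Model ranges are convex, so the mean value inequality is available at boundary and corner
  -- points as well.
  have hconv : Convex ℝ (Metric.ball (e x₀) ρ ∩ range I) :=
    (convex_ball _ _).inter I.convex_range
  rw [← hxx]
  refine ⟨Metric.ball (e x₀) ρ ∩ range I,
    inter_comm (range I) _ ▸ inter_mem_nhdsWithin _ (Metric.ball_mem_nhds _ hρ),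
    fun p hp => (hsub hp).1, hconv, fun p hp => (hsub hp).2, ?_⟩
  intro p hp q hq
  have := hconv.norm_image_sub_le_of_norm_hasFDerivWithin_le' (f := h) (f' := h') (φ := h' (e x₀))
    (C := c) (fun y hy => (hder y (hsub hy).1).mono inter_subset_right)
    (fun y hy => (hsub hy).2) hq hp
  exact this

/-- Around each point of a submanifold, chart coordinates are bi-Lipschitz for the ambient distance,
and `C¹` maps are Lipschitz with a constant governed by their derivative. -/
theorem IsSubmanifoldInclusion.exists_isOpen_biLipschitz (hι : IsSubmanifoldInclusion I ι)
    (x₀ : X) :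
    ∃ V : Set X, IsOpen V ∧ x₀ ∈ V ∧ V ⊆ (extChartAt I x₀).source ∧ ∃ C : ℝ≥0,
      ∀ x ∈ V, ∀ y ∈ V,
        dist (ι x) (ι y) ≤ C * dist (extChartAt I x₀ x) (extChartAt I x₀ y) ∧
        dist (extChartAt I x₀ x) (extChartAt I x₀ y) ≤ C * dist (ι x) (ι y) ∧
        ∀ (G : X → EuclideanSpace ℝ (Fin D)) (k : ℝ), 0 ≤ k →
          ContMDiff I 𝓘(ℝ, EuclideanSpace ℝ (Fin D)) 1 G →
          (∀ x v, ‖ambientDeriv I G x v‖ ≤ k * ‖ambientDeriv I ι x v‖) →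
          dist (G x) (G y) ≤ C * k * dist (ι x) (ι y) := by
  set e := extChartAt I x₀ with he
  set L := ambientDeriv I ι x₀ ∘L chartInvDeriv I x₀ (e x₀) with hL
  have hLinj : Function.Injective L :=
    (hι.immersion x₀).comp (isInvertible_chartInvDeriv (mem_extChartAt_target x₀)).injective
  obtain ⟨a, ha, hLa⟩ := L.toLinearMap.exists_antilipschitzWith (LinearMap.ker_eq_bot.2 hLinj)
  have ha' : (0 : ℝ) < a := by exact_mod_cast ha
  -- `L` expands by at least `1 / a`; an error of half this size leaves an expansion of at least `1
  -- / (2 * a)`.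
  have hc : (0 : ℝ≥0) < 1 / (2 * a) := by positivity
  obtain ⟨t, ht, htt, htc, htd, hta⟩ := hι.exists_approximatesLinearOn x₀ hc
  set Λ : ℝ≥0 := ‖L‖₊ + 1 / (2 * a) with hΛ
  have hlow : ∀ p ∈ t, ∀ q ∈ t, ‖p - q‖ ≤ 2 * a * ‖ι (e.symm p) - ι (e.symm q)‖ := by
    intro p hp q hq
    have h1 : ‖ι (e.symm p) - ι (e.symm q) - L (p - q)‖ ≤ (1 / (2 * a) : ℝ≥0) * ‖p - q‖ :=
      hta p hp q hq
    push_cast at h1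
    have h2 : ‖p - q‖ ≤ a * ‖L (p - q)‖ := by simpa using hLa.le_mul_dist (p - q) 0
    have h3 : ‖L (p - q)‖ ≤ ‖ι (e.symm p) - ι (e.symm q)‖ +
        ‖ι (e.symm p) - ι (e.symm q) - L (p - q)‖ := by
      calc _ = ‖(ι (e.symm p) - ι (e.symm q)) - (ι (e.symm p) - ι (e.symm q) - L (p - q))‖ := by
            simp
        _ ≤ _ := norm_sub_le _ _
    have h4 : a * ‖L (p - q)‖ ≤ a * (‖ι (e.symm p) - ι (e.symm q)‖ + 1 / (2 * a) * ‖p - q‖) := by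
      gcongr; exact h3.trans (by gcongr)
    have h5 : a * (‖ι (e.symm p) - ι (e.symm q)‖ + 1 / (2 * a) * ‖p - q‖) =
        a * ‖ι (e.symm p) - ι (e.symm q)‖ + ‖p - q‖ / 2 := by field_simp
    linarith
  have hder : ∀ p ∈ t, ∀ v,
      ‖ambientDeriv I ι (e.symm p) (chartInvDeriv I x₀ p v)‖ ≤ Λ * ‖v‖ := by
    intro p hp v
    have h1 : ‖ambientDeriv I ι (e.symm p) ∘L chartInvDeriv I x₀ p‖ ≤ Λ := by
      calc _ = ‖(ambientDeriv I ι (e.symm p) ∘L chartInvDeriv I x₀ p - L) + L‖ := by simp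
        _ ≤ _ := norm_add_le _ _
        _ ≤ (1 / (2 * a) : ℝ≥0) + ‖L‖ := by gcongr; exact htd p hp
        _ = Λ := by rw [hΛ, add_comm]; push_cast; rfl
    exact (ambientDeriv I ι (e.symm p) ∘L chartInvDeriv I x₀ p).le_of_opNorm_le h1 v
  have hup : ∀ (G : X → EuclideanSpace ℝ (Fin D)) (k : ℝ), 0 ≤ k →
      (∀ x, MDifferentiableAt I 𝓘(ℝ, EuclideanSpace ℝ (Fin D)) G x) →
      (∀ x v, ‖ambientDeriv I G x v‖ ≤ k * ‖ambientDeriv I ι x v‖) →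
      ∀ p ∈ t, ∀ q ∈ t, ‖G (e.symm p) - G (e.symm q)‖ ≤ k * Λ * ‖p - q‖ := by
    intro G k hk hG hGb p hp q hq
    refine htc.norm_image_sub_le_of_norm_hasFDerivWithin_le (f := G ∘ e.symm)
      (fun y hy => (hasFDerivWithinAt_comp_extChartAt_symm (htt hy) (hG _)).mono
        fun z hz => extChartAt_target_subset_range x₀ (htt hz)) (fun y hy => ?_) hq hp
    refine ContinuousLinearMap.opNorm_le_bound _ (by positivity) fun v => ?_
    refine (hGb _ _).trans ?_
    rw [mul_assoc]
    gcongr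
    exact hder y hy v
  have hpre : e ⁻¹' t ∈ 𝓝 x₀ := by
    rw [← mem_map, map_extChartAt_nhds]; exact ht
  -- The three summands of the constant serve the three claims: `Λ` bounds `ι` by coordinates, `2 *
  -- a` bounds coordinates by `ι`, and their product bounds `G` by `ι`.
  refine ⟨interior (e.source ∩ e ⁻¹' t), isOpen_interior,
    mem_interior_iff_mem_nhds.2 (inter_mem (extChartAt_source_mem_nhds x₀) hpre),
    interior_subset.trans inter_subset_left, 1 * Λ + 2 * a + Λ * (2 * a), ?_⟩
  intro x hx y hy
  replace hx := interior_subset hx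
  replace hy := interior_subset hy
  have hxy := hlow _ hx.2 _ hy.2
  rw [e.left_inv hx.1, e.left_inv hy.1] at hxy
  have hpos : (0 : ℝ) ≤ Λ := Λ.2
  simp only [dist_eq_norm]
  push_cast
  refine ⟨?_, ?_, fun G k hk hG hGb => ?_⟩
  · have := hup ι 1 zero_le_one hι.mdifferentiableAt (fun x v => (one_mul _).ge) _ hx.2 _ hy.2
    rw [e.left_inv hx.1, e.left_inv hy.1] at this
    refine this.trans ?_
    gcongr
    nlinarith [mul_nonneg hpos ha'.le]
  · refine hxy.trans ?_
    gcongr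
    nlinarith [mul_nonneg hpos ha'.le]
  · have := hup G k hk (hG.mdifferentiable one_ne_zero) hGb _ hx.2 _ hy.2
    rw [e.left_inv hx.1, e.left_inv hy.1] at this
    calc ‖G x - G y‖ ≤ k * Λ * ‖e x - e y‖ := this
      _ ≤ k * Λ * (2 * a * ‖ι x - ι y‖) := by gcongr
      _ = Λ * (2 * a) * k * ‖ι x - ι y‖ := by ring
      _ ≤ _ := by gcongr; nlinarith

/-- On a compact submanifold, a map of `C¹` norm at most `k` is `C k`-Lipschitz for the ambient
distance, where `C` depends on the submanifold only. -/
theorem IsSubmanifoldInclusion.exists_forall_dist_le [CompactSpace X]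
    (hι : IsSubmanifoldInclusion I ι) :
    ∃ C : ℝ≥0, ∀ (G : X → EuclideanSpace ℝ (Fin D)) (k : ℝ), 0 ≤ k →
      ContMDiff I 𝓘(ℝ, EuclideanSpace ℝ (Fin D)) 1 G → (∀ x, ‖G x‖ ≤ k) →
      (∀ x v, ‖ambientDeriv I G x v‖ ≤ k * ‖ambientDeriv I ι x v‖) →
      ∀ x y, dist (G x) (G y) ≤ C * k * dist (ι x) (ι y) := by
  suffices h : ∃ C : ℝ≥0, ∀ xy ∈ (univ : Set (X × X)),
      ∀ (G : X → EuclideanSpace ℝ (Fin D)) (k : ℝ), 0 ≤ k →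
      ContMDiff I 𝓘(ℝ, EuclideanSpace ℝ (Fin D)) 1 G → (∀ x, ‖G x‖ ≤ k) →
      (∀ x v, ‖ambientDeriv I G x v‖ ≤ k * ‖ambientDeriv I ι x v‖) →
      dist (G xy.1) (G xy.2) ≤ C * k * dist (ι xy.1) (ι xy.2) by
    obtain ⟨C, hC⟩ := h
    exact ⟨C, fun G k hk hG hb hd x y => hC (x, y) (mem_univ _) G k hk hG hb hd⟩
  -- Compactness of `X × X`: near the diagonal the derivative bound applies in a chart; off it, `‖G‖
  -- ≤ k` suffices because the ambient distance is bounded below.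
  refine isCompact_univ.induction_on ⟨0, fun _ h => absurd h (notMem_empty _)⟩ ?_ ?_ ?_
  · rintro s t hst ⟨C, hC⟩
    exact ⟨C, fun xy h => hC xy (hst h)⟩
  · rintro s t ⟨C, hC⟩ ⟨C', hC'⟩
    refine ⟨max C C', fun xy h G k hk hG hb hd => ?_⟩
    rcases h with h | h
    · refine (hC xy h G k hk hG hb hd).trans ?_
      gcongr; exact le_max_left _ _
    · refine (hC' xy h G k hk hG hb hd).trans ?_
      gcongr; exact le_max_right _ _
  · rintro ⟨x, y⟩ -
    rw [nhdsWithin_univ]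
    rcases eq_or_ne x y with rfl | hxy
    · obtain ⟨V, hVo, hxV, -, C, hC⟩ := hι.exists_isOpen_biLipschitz x
      exact ⟨V ×ˢ V, prod_mem_nhds (hVo.mem_nhds hxV) (hVo.mem_nhds hxV), C,
        fun xy h G k hk hG hb hd => (hC _ h.1 _ h.2).2.2 G k hk hG hd⟩
    · have hpos : 0 < dist (ι x) (ι y) := dist_pos.2 (hι.injective.ne hxy)
      set δ : ℝ≥0 := ⟨dist (ι x) (ι y) / 2, by positivity⟩ with hδ
      have hδ0 : (0 : ℝ) < δ := half_pos hpos
      have hcont : Continuous fun xy : X × X => dist (ι xy.1) (ι xy.2) :=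
        (hι.smooth.continuous.comp continuous_fst).dist (hι.smooth.continuous.comp continuous_snd)
      refine ⟨{xy | δ < dist (ι xy.1) (ι xy.2)},
        (isOpen_lt continuous_const hcont).mem_nhds (half_lt_self hpos), 2 / δ,
        fun xy h G k hk hG hb hd => ?_⟩
      have h' : (δ : ℝ) < dist (ι xy.1) (ι xy.2) := h
      calc dist (G xy.1) (G xy.2) ≤ ‖G xy.1‖ + ‖G xy.2‖ := dist_le_norm_add_norm _ _
        _ ≤ k + k := add_le_add (hb _) (hb _)
        _ = 2 / δ * k * δ := by field_simp; ring
        _ ≤ _ := by push_cast; gcongr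

end Submanifold

/-! ### Surface measure and change of variables -/

section SurfaceMeasure

variable {d D : ℕ} {H : Type*} [TopologicalSpace H]
  {I : ModelWithCorners ℝ (EuclideanSpace ℝ (Fin d)) H}
  {X : Type*} [TopologicalSpace X] [ChartedSpace H X]
  {ι : X → EuclideanSpace ℝ (Fin D)}

variable (I) in
/-- The volume factor of `f` at the point with coordinates `p` in the chart at `x₀`, relative to
Lebesgue measure in these coordinates. -/
noncomputable def chartVolumeFactor (f : X → EuclideanSpace ℝ (Fin D)) (x₀ : X)
    (p : EuclideanSpace ℝ (Fin d)) : ℝ :=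
  volumeFactor I f ((extChartAt I x₀).symm p) *
    |LinearMap.det (chartInvDeriv I x₀ p).toLinearMap|

theorem normDet_comp_chartInvDeriv (f : X → EuclideanSpace ℝ (Fin D)) (x₀ : X)
    (p : EuclideanSpace ℝ (Fin d)) :
    (ambientDeriv I f ((extChartAt I x₀).symm p) ∘L
      chartInvDeriv I x₀ p).toLinearMap.normDet = chartVolumeFactor I f x₀ p := by
  rw [chartVolumeFactor, ContinuousLinearMap.toLinearMap_comp,
    LinearMap.normDet_comp_of_finrank_eq _ _ rfl, LinearMap.normDet_eq_abs_det]
  rfl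

theorem volumeFactor_pos {f : X → EuclideanSpace ℝ (Fin D)} {x : X}
    (hf : Function.Injective (ambientDeriv I f x)) : 0 < volumeFactor I f x := by
  refine lt_of_le_of_ne (LinearMap.normDet_nonneg _) (Ne.symm fun h => ?_)
  exact LinearMap.normDet_eq_zero_iff_ker_ne_bot.1 h (LinearMap.ker_eq_bot.2 hf)

/-- The (unnormalised) surface measure of a submanifold. -/
noncomputable def surfaceMeasure (d : ℕ) [MeasurableSpace X] (ι : X → EuclideanSpace ℝ (Fin D)) :
    Measure X :=
  μHE[d].comap ι

variable [MeasurableSpace X] [BorelSpace X]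

theorem aemeasurable_extChartAt_restrict {x₀ : X} {W : Set X} (hW : MeasurableSet W)
    (hWs : W ⊆ (extChartAt I x₀).source) (μ : Measure X) :
    AEMeasurable (extChartAt I x₀) (μ.restrict W) :=
  ((continuousOn_extChartAt x₀).mono hWs).aemeasurable hW

variable [CompactSpace X]

theorem IsSubmanifoldInclusion.surfaceMeasure_apply (hι : IsSubmanifoldInclusion I ι) (A : Set X) :
    surfaceMeasure d ι A = μHE[d] (ι '' A) :=
  hι.measurableEmbedding.comap_apply _ _

theorem IsSubmanifoldInclusion.surfaceMeasure_image_le (hι : IsSubmanifoldInclusion I ι)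
    {Ψ : X → X} {K : ℝ≥0} (hΨ : ∀ x y, dist (ι (Ψ x)) (ι (Ψ y)) ≤ K * dist (ι x) (ι y))
    (A : Set X) : surfaceMeasure d ι (Ψ '' A) ≤ (K : ℝ≥0∞) ^ d * surfaceMeasure d ι A := by
  rw [hι.surfaceMeasure_apply, hι.surfaceMeasure_apply, image_image]
  exact euclideanHausdorffMeasure_image_le_of_dist_le d fun x _ y _ => hΨ x y

theorem IsSubmanifoldInclusion.measurableSet_extChartAt_image (hι : IsSubmanifoldInclusion I ι)
    {x₀ : X} {W : Set X} (hW : MeasurableSet W) (hWs : W ⊆ (extChartAt I x₀).source) :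
    MeasurableSet (extChartAt I x₀ '' W) := by
  have := hι.polishSpace
  exact hW.image_of_continuousOn_injOn ((continuousOn_extChartAt x₀).mono hWs)
    ((extChartAt I x₀).injOn.mono hWs)

variable [IsManifold I ∞ X]

/-- The area formula in a chart. -/
theorem IsSubmanifoldInclusion.area_formula (hι : IsSubmanifoldInclusion I ι)
    {f : X → EuclideanSpace ℝ (Fin D)} {x₀ : X} {W : Set X} (hW : MeasurableSet W)
    (hWs : W ⊆ (extChartAt I x₀).source) (hf : InjOn f W)
    (hfd : ∀ x ∈ W, MDifferentiableAt I 𝓘(ℝ, EuclideanSpace ℝ (Fin D)) f x)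
    (hfi : ∀ x ∈ W, Function.Injective (ambientDeriv I f x)) :
    AEMeasurable (chartVolumeFactor I f x₀) (volume.restrict (extChartAt I x₀ '' W)) ∧
    μHE[d] (f '' W) =
      ∫⁻ p in extChartAt I x₀ '' W, ENNReal.ofReal (chartVolumeFactor I f x₀ p) := by
  set e := extChartAt I x₀ with he
  have hS := hι.measurableSet_extChartAt_image hW hWs
  have hsymm : ∀ x ∈ W, e.symm (e x) = x := fun x hx => e.left_inv (hWs hx)
  have hder : ∀ p ∈ e '' W, HasFDerivWithinAt (f ∘ e.symm)
      (ambientDeriv I f (e.symm p) ∘L chartInvDeriv I x₀ p) (e '' W) p := by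
    rintro _ ⟨x, hx, rfl⟩
    refine (hasFDerivWithinAt_comp_extChartAt_symm (e.map_source (hWs hx)) ?_).mono ?_
    · rw [← he, hsymm x hx]; exact hfd x hx
    · rintro _ ⟨y, hy, rfl⟩
      exact extChartAt_target_subset_range x₀ (e.map_source (hWs hy))
  have himg : (f ∘ e.symm) '' (e '' W) = f '' W := by
    rw [image_image]
    exact image_congr fun x hx => by simp [hsymm x hx]
  have h1 := aemeasurable_normDet_fderivWithin hS _ hder
  have h2 := euclideanHausdorffMeasure_image_eq_lintegral_normDet hS _ hder ?_ ?_
  · simp only [he, normDet_comp_chartInvDeriv] at h1 h2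
    rw [← he, himg] at h2
    exact ⟨h1, h2⟩
  · rintro _ ⟨x, hx, rfl⟩ _ ⟨y, hy, rfl⟩ hxy
    simp only [Function.comp_apply, ← he, hsymm x hx, hsymm y hy] at hxy
    rw [hf hx hy hxy]
  · rintro _ ⟨x, hx, rfl⟩
    have hx' := hfi x hx
    rw [← hsymm x hx] at hx'
    exact hx'.comp (isInvertible_chartInvDeriv (e.map_source (hWs hx))).injective

/-- The surface measure in a chart. -/
theorem IsSubmanifoldInclusion.map_extChartAt_surfaceMeasure (hι : IsSubmanifoldInclusion I ι)
    {x₀ : X} {W : Set X} (hW : MeasurableSet W) (hWs : W ⊆ (extChartAt I x₀).source) :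
    ((surfaceMeasure d ι).restrict W).map (extChartAt I x₀) =
      (volume.restrict (extChartAt I x₀ '' W)).withDensity
        fun p => ENNReal.ofReal (chartVolumeFactor I ι x₀ p) := by
  have hae := aemeasurable_extChartAt_restrict hW hWs (surfaceMeasure d ι)
  ext B hB
  have hm : MeasurableSet (W ∩ extChartAt I x₀ ⁻¹' B) := by
    have h := hW.subtype_image
      (((continuousOn_extChartAt (I := I) x₀).mono hWs).domRestrict.measurable hB)
    convert h using 1
    ext x; simp [and_comm]
  rw [Measure.map_apply_of_aemeasurable hae hB, withDensity_apply _ hB,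
    Measure.restrict_restrict hB]
  have hpre : (surfaceMeasure d ι).restrict W (extChartAt I x₀ ⁻¹' B) =
      surfaceMeasure d ι (W ∩ extChartAt I x₀ ⁻¹' B) := by
    rw [Measure.restrict_apply' hW, inter_comm]
  have himg : extChartAt I x₀ '' (W ∩ extChartAt I x₀ ⁻¹' B) = B ∩ extChartAt I x₀ '' W := by
    rw [image_inter_preimage, inter_comm]
  rw [hpre, hι.surfaceMeasure_apply, (hι.area_formula hm (inter_subset_left.trans hWs)
    hι.injective.injOn (fun x _ => hι.mdifferentiableAt x) (fun x _ => hι.immersion x)).2, himg]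

/-- Change of variables on a measurable set on which the map is differentiable with injective
derivative. -/
theorem IsSubmanifoldInclusion.lintegral_absDet_of_mdifferentiableAt
    (hι : IsSubmanifoldInclusion I ι) {Ψ : X → X} (hΨ : Function.Injective Ψ) {x₀ : X} {W : Set X}
    (hW : MeasurableSet W) (hWs : W ⊆ (extChartAt I x₀).source)
    (hd : ∀ x ∈ W, MDifferentiableAt I I Ψ x)
    (hi : ∀ x ∈ W, Function.Injective (selfDeriv I Ψ x)) :
    AEMeasurable (absDet I ι Ψ) ((surfaceMeasure d ι).restrict W) ∧
    surfaceMeasure d ι (Ψ '' W) =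
      ∫⁻ x in W, ENNReal.ofReal (absDet I ι Ψ x) ∂surfaceMeasure d ι := by
  set e := extChartAt I x₀ with he
  have hae := aemeasurable_extChartAt_restrict hW hWs (surfaceMeasure d ι)
  have hmap := hι.map_extChartAt_surfaceMeasure hW hWs
  have hS := hι.measurableSet_extChartAt_image hW hWs
  have hchain : ∀ x ∈ W, ambientDeriv I (ι ∘ Ψ) x =
      ambientDeriv I ι (Ψ x) ∘L selfDeriv I Ψ x := fun x hx =>
    mfderiv_comp x (hι.mdifferentiableAt _) (hd x hx)
  obtain ⟨m0, h0⟩ := hι.area_formula hW hWs hι.injective.injOn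
    (fun x _ => hι.mdifferentiableAt x) (fun x _ => hι.immersion x)
  obtain ⟨m1, h1⟩ := hι.area_formula hW hWs (hι.injective.comp hΨ).injOn
    (fun x hx => (hι.mdifferentiableAt _).comp x (hd x hx))
    (fun x hx => by rw [hchain x hx]; exact (hι.immersion _).comp (hi x hx))
  have hpos : ∀ x ∈ W, 0 < chartVolumeFactor I ι x₀ (e x) := by
    intro x hx
    refine mul_pos (volumeFactor_pos (hι.immersion _)) (abs_pos.2 fun h => ?_)
    have hinj := (isInvertible_chartInvDeriv (I := I) (e.map_source (hWs hx))).injective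
    exact LinearMap.det_eq_zero_iff_ker_ne_bot.1 h (LinearMap.ker_eq_bot.2 hinj)
  have hq : ∀ x ∈ W, chartVolumeFactor I (ι ∘ Ψ) x₀ (e x) =
      absDet I ι Ψ x * chartVolumeFactor I ι x₀ (e x) := by
    intro x hx
    have hv := (volumeFactor_pos (hι.immersion x)).ne'
    have h2 : volumeFactor I (ι ∘ Ψ) x =
        volumeFactor I ι (Ψ x) * |LinearMap.det (selfDeriv I Ψ x).toLinearMap| := by
      rw [volumeFactor, hchain x hx, ContinuousLinearMap.toLinearMap_comp,
        LinearMap.normDet_comp_of_finrank_eq _ _ rfl, LinearMap.normDet_eq_abs_det]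
      rfl
    rw [chartVolumeFactor, chartVolumeFactor, ← he, e.left_inv (hWs hx), h2, absDet]
    field_simp
  -- The preferred charts in the definition of `absDet` vary arbitrarily with the point. In the
  -- single chart at `x₀` it becomes a quotient of two densities, each measurable by the area
  -- formula.
  set q : EuclideanSpace ℝ (Fin d) → ℝ := fun p =>
    chartVolumeFactor I (ι ∘ Ψ) x₀ p / chartVolumeFactor I ι x₀ p with hqdef
  have hqm : AEMeasurable q (((surfaceMeasure d ι).restrict W).map e) := by
    rw [hmap]
    exact (m1.div m0).mono_ac (withDensity_absolutelyContinuous _ _)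
  have hqe : ∀ x ∈ W, q (e x) = absDet I ι Ψ x := fun x hx => by
    rw [hqdef]; simp only [hq x hx]; exact mul_div_cancel_right₀ _ (hpos x hx).ne'
  refine ⟨(hqm.comp_aemeasurable hae).congr ?_, ?_⟩
  · filter_upwards [ae_restrict_mem hW] with x hx using hqe x hx
  · have h3 : ∫⁻ x in W, ENNReal.ofReal (absDet I ι Ψ x) ∂surfaceMeasure d ι =
        ∫⁻ x in W, ENNReal.ofReal (q (e x)) ∂surfaceMeasure d ι :=
      setLIntegral_congr_fun hW fun x hx => by rw [hqe x hx]
    rw [h3, ← lintegral_map' (f := fun p => ENNReal.ofReal (q p)) hqm.ennreal_ofReal hae, hmap,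
      lintegral_withDensity_eq_lintegral_mul₀' m0.ennreal_ofReal (hmap ▸ hqm.ennreal_ofReal),
      hι.surfaceMeasure_apply, image_image]
    refine h1.trans (setLIntegral_congr_fun hS ?_)
    rintro _ ⟨x, hx, rfl⟩
    simp only [Pi.mul_apply]
    rw [← ENNReal.ofReal_mul (hpos x hx).le, hqe x hx, hq x hx, mul_comm]

/-- Rademacher's theorem for Lipschitz self-maps of a submanifold. -/
theorem IsSubmanifoldInclusion.ae_mdifferentiableAt_of_dist_le (hι : IsSubmanifoldInclusion I ι)
    {Ψ : X → X} {K : ℝ≥0} (hΨ : ∀ x y, dist (ι (Ψ x)) (ι (Ψ y)) ≤ K * dist (ι x) (ι y)) :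
    ∀ᵐ x ∂surfaceMeasure d ι, MDifferentiableAt I I Ψ x := by
  have : IsManifold I 1 X := IsManifold.of_le (n := ∞) (by simp)
  have := hι.polishSpace
  have hcont := hι.continuous_of_dist_le hΨ
  refine measure_null_of_locally_null _ fun x₀ _ => ?_
  obtain ⟨V, hVo, hxV, hVs, C, hC⟩ := hι.exists_isOpen_biLipschitz x₀
  obtain ⟨V', hVo', hxV', hVs', C', hC'⟩ := hι.exists_isOpen_biLipschitz (Ψ x₀)
  set W := V ∩ Ψ ⁻¹' V' with hWdef
  have hWo : IsOpen W := hVo.inter (hVo'.preimage hcont)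
  have hWs : W ⊆ (extChartAt I x₀).source := inter_subset_left.trans hVs
  refine ⟨_, inter_mem_nhdsWithin _ (hWo.mem_nhds ⟨hxV, hxV'⟩), ?_⟩
  have hlip : LipschitzOnWith (C' * K * C)
      (extChartAt I (Ψ x₀) ∘ Ψ ∘ (extChartAt I x₀).symm) (extChartAt I x₀ '' W) := by
    refine LipschitzOnWith.of_dist_le_mul ?_
    rintro _ ⟨x, hx, rfl⟩ _ ⟨y, hy, rfl⟩
    simp only [Function.comp_apply, (extChartAt I x₀).left_inv (hWs hx),
      (extChartAt I x₀).left_inv (hWs hy)]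
    calc _ ≤ C' * dist (ι (Ψ x)) (ι (Ψ y)) := (hC' _ hx.2 _ hy.2).2.1
      _ ≤ C' * (K * (C * dist (extChartAt I x₀ x) (extChartAt I x₀ y))) := by
        gcongr
        exact (hΨ x y).trans (by gcongr; exact (hC _ hx.1 _ hy.1).1)
      _ = _ := by push_cast; ring
  have hrad := hlip.ae_differentiableWithinAt (μ := volume)
    (hι.measurableSet_extChartAt_image hWo.measurableSet hWs)
  have hae := aemeasurable_extChartAt_restrict hWo.measurableSet hWs (surfaceMeasure d ι)
  have hmap : ∀ᵐ p ∂((surfaceMeasure d ι).restrict W).map (extChartAt I x₀),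
      DifferentiableWithinAt ℝ (extChartAt I (Ψ x₀) ∘ Ψ ∘ (extChartAt I x₀).symm)
        (extChartAt I x₀ '' W) p := by
    rw [hι.map_extChartAt_surfaceMeasure hWo.measurableSet hWs]
    exact (withDensity_absolutelyContinuous _ _).ae_le hrad
  have hW : ∀ᵐ x ∂(surfaceMeasure d ι).restrict W, MDifferentiableAt I I Ψ x := by
    filter_upwards [ae_of_ae_map hae hmap, ae_restrict_mem hWo.measurableSet] with x hx hxW
    have hxs : x ∈ (chartAt H x₀).source := by
      rw [← extChartAt_source (I := I)]; exact hWs hxW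
    have hys : Ψ x ∈ (chartAt H (Ψ x₀)).source := by
      rw [← extChartAt_source (I := I)]; exact hVs' hxW.2
    refine (mdifferentiableAt_iff_of_mem_source hxs hys).2 ⟨hcont.continuousAt, ?_⟩
    -- `W` is open, so its chart image is a neighbourhood of the point within `range I`.
    refine hx.mono_of_mem_nhdsWithin ?_
    rw [← map_extChartAt_nhds' (hWs hxW)]
    exact image_mem_map (hWo.mem_nhds hxW)
  rw [ae_restrict_iff' hWo.measurableSet] at hW
  refine measure_mono_null ?_ hW
  rintro x ⟨hx, hxW⟩ h
  exact hx (h hxW)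

/-- The change of variables formula for bi-Lipschitz self-maps of a submanifold. -/
theorem IsSubmanifoldInclusion.map_withDensity_absDet (hι : IsSubmanifoldInclusion I ι)
    {Ψ Φ : X → X} {K : ℝ≥0} (hΨ : ∀ x y, dist (ι (Ψ x)) (ι (Ψ y)) ≤ K * dist (ι x) (ι y))
    (hΦ : ∀ x y, dist (ι (Φ x)) (ι (Φ y)) ≤ K * dist (ι x) (ι y))
    (hl : Function.LeftInverse Φ Ψ) (hr : Function.RightInverse Φ Ψ) :
    AEMeasurable (absDet I ι Ψ) (surfaceMeasure d ι) ∧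
    ((surfaceMeasure d ι).withDensity fun x => ENNReal.ofReal (absDet I ι Ψ x)).map Ψ =
      surfaceMeasure d ι := by
  have := hι.polishSpace
  set μ := surfaceMeasure d ι with hμ
  have hΨc := hι.continuous_of_dist_le hΨ
  have hΨi : Function.Injective Ψ := hl.injective
  have hemb : MeasurableEmbedding Ψ :=
    (Homeomorph.mk ⟨Ψ, Φ, hl, hr⟩ hΨc (hι.continuous_of_dist_le hΦ)).measurableEmbedding
  have hnull : ∀ {Θ : X → X}, (∀ x y, dist (ι (Θ x)) (ι (Θ y)) ≤ K * dist (ι x) (ι y)) →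
      ∀ {A : Set X}, μ A = 0 → μ (Θ '' A) = 0 := by
    intro Θ hΘ A hA
    have := hι.surfaceMeasure_image_le hΘ A
    rw [← hμ, hA, mul_zero] at this
    exact le_antisymm this zero_le
  -- The points where `Φ` fails to be differentiable at `Ψ x` form the `Φ`-image of a null set. Off
  -- the exceptional set the chain rule for `Φ ∘ Ψ = id` makes `DΨ` injective.
  have hgood : ∀ᵐ x ∂μ, MDifferentiableAt I I Ψ x ∧ MDifferentiableAt I I Φ (Ψ x) := by
    refine (hι.ae_mdifferentiableAt_of_dist_le hΨ).and ?_
    have h1 : μ {y | ¬ MDifferentiableAt I I Φ y} = 0 := hι.ae_mdifferentiableAt_of_dist_le hΦ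
    refine measure_mono_null (fun x hx => ?_) (hnull hΦ h1)
    exact ⟨Ψ x, hx, hl x⟩
  obtain ⟨T, hbT, hTm, hT⟩ := exists_measurable_superset_of_null hgood
  have hT' : ∀ x, x ∉ T → MDifferentiableAt I I Ψ x ∧ Function.Injective (selfDeriv I Ψ x) := by
    intro x hx
    obtain ⟨h1, h2⟩ : MDifferentiableAt I I Ψ x ∧ MDifferentiableAt I I Φ (Ψ x) :=
      by_contra fun h => hx (hbT h)
    refine ⟨h1, ?_⟩
    have h3 : selfDeriv I (Φ ∘ Ψ) x = selfDeriv I Φ (Ψ x) ∘L selfDeriv I Ψ x :=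
      mfderiv_comp x h2 h1
    have h4 : selfDeriv I (Φ ∘ Ψ) x = ContinuousLinearMap.id ℝ _ := by
      rw [show Φ ∘ Ψ = id from funext hl]; exact mfderiv_id
    refine Function.Injective.of_comp (f := selfDeriv I Φ (Ψ x)) ?_
    rw [← ContinuousLinearMap.coe_comp, ← h3, h4]
    exact Function.injective_id
  obtain ⟨s, hs, hsU⟩ := TopologicalSpace.countable_cover_nhds
    (fun x : X => extChartAt_source_mem_nhds (I := I) x)
  have := hs.to_subtype
  rw [biUnion_eq_iUnion] at hsU
  have hlocal : ∀ (x₀ : X) (A : Set X), MeasurableSet A → A ⊆ (extChartAt I x₀).source →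
      AEMeasurable (absDet I ι Ψ) (μ.restrict A) ∧
      μ (Ψ '' A) = ∫⁻ x in A, ENNReal.ofReal (absDet I ι Ψ x) ∂μ := by
    intro x₀ A hA hAs
    -- Removing `T` changes neither side: `T` is null, and so is its image under the Lipschitz map
    -- `Ψ`.
    obtain ⟨h1, h2⟩ := hι.lintegral_absDet_of_mdifferentiableAt hΨi (hA.diff hTm)
      (sdiff_subset.trans hAs) (fun x hx => (hT' x hx.2).1) (fun x hx => (hT' x hx.2).2)
    have hAT : (A \ T : Set X) =ᵐ[μ] A := sdiff_null_ae_eq_self hT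
    rw [← hμ, Measure.restrict_congr_set hAT] at h1
    rw [← hμ, setLIntegral_congr hAT] at h2
    refine ⟨h1, h2 ▸ le_antisymm ?_ (measure_mono (image_mono sdiff_subset))⟩
    calc μ (Ψ '' A) ≤ μ (Ψ '' (A \ T) ∪ Ψ '' T) := measure_mono (by
          rw [← image_union]; exact image_mono (by rw [sdiff_union_self]; exact subset_union_left))
      _ ≤ μ (Ψ '' (A \ T)) + μ (Ψ '' T) := measure_union_le _ _
      _ = μ (Ψ '' (A \ T)) := by rw [hnull hΨ hT, add_zero]
  have hso : ∀ x : X, MeasurableSet (extChartAt I x).source := fun x =>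
    (isOpen_extChartAt_source x).measurableSet
  refine ⟨?_, ?_⟩
  · rw [← Measure.restrict_univ (μ := μ), ← hsU, aemeasurable_iUnion_iff]
    exact fun x => (hlocal x _ (hso x) subset_rfl).1
  · have hcomap : μ.withDensity (fun x => ENNReal.ofReal (absDet I ι Ψ x)) = μ.comap Ψ := by
      refine (Measure.ext_iff_of_iUnion_eq_univ hsU).2 fun x => ?_
      ext A hA
      rw [Measure.restrict_apply hA, Measure.restrict_apply hA, hemb.comap_apply,
        withDensity_apply _ (hA.inter (hso x)),
        (hlocal x _ (hA.inter (hso x)) inter_subset_right).2]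
    rw [hcomap, hemb.map_comap, hr.surjective.range_eq, Measure.restrict_univ]

end SurfaceMeasure

/-! ### Integrals along a family of maps -/

theorem integrable_and_integral_comp_mul {X : Type*} [MeasurableSpace X] {m : Measure X}
    {Ψ : X → X} {j : X → ℝ} (hΨ : MeasurableEmbedding Ψ) (hj : AEMeasurable j m)
    (hj0 : ∀ x, 0 ≤ j x) (hmap : (m.withDensity fun x => ENNReal.ofReal (j x)).map Ψ = m)
    {g : X → ℝ} (hg : Integrable g m) :
    Integrable (fun x => g (Ψ x) * j x) m ∧ ∫ x, g (Ψ x) * j x ∂m = ∫ x, g x ∂m := by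
  have hsmul : (fun x => (j x).toNNReal • g (Ψ x)) = fun x => g (Ψ x) * j x := by
    funext x
    rw [NNReal.smul_def, Real.coe_toNNReal _ (hj0 x), smul_eq_mul, mul_comm]
  constructor
  · rw [← hmap, hΨ.integrable_map_iff] at hg
    have := (integrable_withDensity_iff_integrable_smul₀ hj.real_toNNReal).1 hg
    rwa [← hsmul]
  · conv_rhs => rw [← hmap, hΨ.integral_map]
    rw [← hsmul]
    exact (integral_withDensity_eq_integral_smul₀ hj.real_toNNReal (fun x => g (Ψ x))).symm

/-- If the maps `Φ t` converge pointwise and do not expand measure too much, then the integral of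
`χ_A ∘ Φ t` against a bounded function converges, for every measurable set `A`. -/
theorem tendsto_integral_indicator_comp_mul {X : Type*} [TopologicalSpace X]
    [TopologicalSpace.PseudoMetrizableSpace X] [MeasurableSpace X] [BorelSpace X] {m : Measure X}
    [IsFiniteMeasure m] {Φ : ℝ → X → X} {t₀ : ℝ}
    (hΦ : ∀ x, Tendsto (fun t => Φ t x) (𝓝 t₀) (𝓝 (Φ t₀ x))) {C : ℝ≥0}
    (hC : ∀ᶠ t in 𝓝 t₀, Measurable (Φ t) ∧ m.map (Φ t) ≤ (C : ℝ≥0∞) • m) {f : X → ℝ}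
    (hf : Measurable f) {M : ℝ} (hM : ∀ x, |f x| ≤ M) {A : Set X} (hA : MeasurableSet A) :
    Tendsto (fun t => ∫ x, A.indicator (1 : X → ℝ) (Φ t x) * f x ∂m) (𝓝 t₀)
      (𝓝 (∫ x, A.indicator (1 : X → ℝ) (Φ t₀ x) * f x ∂m)) := by
  have h1A : Integrable (A.indicator (1 : X → ℝ)) m := (integrable_const 1).indicator hA
  have hM0 : ∀ x : X, 0 ≤ M := fun x => (abs_nonneg _).trans (hM x)
  rcases isEmpty_or_nonempty X with hX | ⟨⟨x₀⟩⟩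
  · simp [Measure.eq_zero_of_isEmpty]
  replace hM0 := hM0 x₀
  -- Replacing `χ_A` by `g` costs at most `C M ‖χ_A - g‖₁`, with a bound independent of `t`.
  have key : ∀ (g : BoundedContinuousFunction X ℝ) (t : ℝ), Measurable (Φ t) →
      m.map (Φ t) ≤ (C : ℝ≥0∞) • m →
      Integrable (fun x => g (Φ t x) * f x) m ∧
      |∫ x, A.indicator (1 : X → ℝ) (Φ t x) * f x ∂m - ∫ x, g (Φ t x) * f x ∂m| ≤
        C * M * ∫ x, ‖A.indicator (1 : X → ℝ) x - g x‖ ∂m := by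
    intro g t hm hle
    have hfb : ∀ᵐ x ∂m, ‖f x‖ ≤ M := Eventually.of_forall hM
    have hi1 : Integrable (fun x => A.indicator (1 : X → ℝ) (Φ t x) * f x) m := by
      refine Integrable.mul_bdd (c := M) ?_ hf.aestronglyMeasurable hfb
      exact (integrable_const (1 : ℝ)).indicator (hm hA)
    have hgm : Measurable fun x => g (Φ t x) := g.continuous.measurable.comp hm
    have hi2 : Integrable (fun x => g (Φ t x) * f x) m :=
      Integrable.mul_bdd (c := M) (Integrable.of_bound hgm.aestronglyMeasurable ‖g‖
        (Eventually.of_forall fun x => g.norm_coe_le_norm _)) hf.aestronglyMeasurable hfb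
    refine ⟨hi2, ?_⟩
    set h : X → ℝ := fun x => ‖A.indicator (1 : X → ℝ) x - g x‖ with hh
    have hgi : Integrable g m := g.integrable m
    have hint : Integrable h m := (h1A.sub hgi).norm
    have hintC : Integrable h ((C : ℝ≥0∞) • m) := hint.smul_measure ENNReal.coe_ne_top
    have hintm : Integrable h (m.map (Φ t)) := hintC.mono_measure hle
    have hintc : Integrable (fun x => h (Φ t x)) m := hintm.comp_measurable hm
    rw [← integral_sub hi1 hi2]
    calc |∫ x, (A.indicator (1 : X → ℝ) (Φ t x) * f x - g (Φ t x) * f x) ∂m|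
        ≤ ∫ x, |A.indicator (1 : X → ℝ) (Φ t x) * f x - g (Φ t x) * f x| ∂m :=
          abs_integral_le_integral_abs
      _ ≤ ∫ x, M * h (Φ t x) ∂m := by
          refine integral_mono (hi1.sub hi2).abs (hintc.const_mul M) fun x => ?_
          simp only [← sub_mul, abs_mul, hh, Real.norm_eq_abs]
          rw [mul_comm]
          exact mul_le_mul_of_nonneg_right (hM x) (abs_nonneg _)
      _ = M * ∫ x, h x ∂(m.map (Φ t)) := by
          rw [integral_const_mul, integral_map hm.aemeasurable hintm.aestronglyMeasurable]
      _ ≤ M * ∫ x, h x ∂((C : ℝ≥0∞) • m) := by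
          refine mul_le_mul_of_nonneg_left ?_ hM0
          exact integral_mono_measure hle (Eventually.of_forall fun x => norm_nonneg _) hintC
      _ = C * M * ∫ x, h x ∂m := by
          rw [integral_smul_measure]; simp; ring
  rw [Metric.tendsto_nhds]
  intro ε hε
  -- Two replacement errors of `ε / 4` and one convergence error of `ε / 2`; the `+ 1` keeps the
  -- denominator positive when `C M = 0`.
  obtain ⟨g, hg, -⟩ := h1A.exists_boundedContinuous_integral_sub_le
    (ε := ε / (4 * (C * M + 1))) (by positivity)
  have hsmall : C * M * ∫ x, ‖A.indicator (1 : X → ℝ) x - g x‖ ∂m ≤ ε / 4 := by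
    calc _ ≤ (C * M + 1) * (ε / (4 * (C * M + 1))) := by
          gcongr; linarith
      _ = ε / 4 := by field_simp
  have hlim : Tendsto (fun t => ∫ x, g (Φ t x) * f x ∂m) (𝓝 t₀)
      (𝓝 (∫ x, g (Φ t₀ x) * f x ∂m)) := by
    refine tendsto_integral_filter_of_dominated_convergence (fun _ => ‖g‖ * M) ?_ ?_
      (integrable_const _) ?_
    · filter_upwards [hC] with t ht
      exact (key g t ht.1 ht.2).1.aestronglyMeasurable
    · refine Eventually.of_forall fun t => Eventually.of_forall fun x => ?_
      rw [norm_mul]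
      exact mul_le_mul (g.norm_coe_le_norm _) (hM x) (norm_nonneg _) (norm_nonneg _)
    · exact Eventually.of_forall fun x =>
        ((g.continuous.tendsto _).comp (hΦ x)).mul_const _
  filter_upwards [hC, Metric.tendsto_nhds.1 hlim (ε / 2) (by positivity)] with t ht hgt
  have e1 := (key g t ht.1 ht.2).2.trans hsmall
  have e2 := (key g t₀ hC.self_of_nhds.1 hC.self_of_nhds.2).2.trans hsmall
  rw [Real.dist_eq] at hgt ⊢
  rw [abs_le] at e1 e2
  rw [abs_lt] at hgt ⊢
  constructor <;> linarith [e1.1, e1.2, e2.1, e2.2, hgt.1, hgt.2]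

/-! ### The flow -/

/-- In `ℝ≥0∞`, `a⁻¹ * a ≤ 1` holds also for `a = 0` and `a = ∞`, so the total surface area need not
be known to be finite. -/
theorem isFiniteMeasure_lebesgue {d D : ℕ} {X : Type*} [MeasurableSpace X]
    {ι : X → EuclideanSpace ℝ (Fin D)} : IsFiniteMeasure (lebesgue d ι) :=
  ⟨by
    rw [lebesgue, Measure.smul_apply, smul_eq_mul]
    exact (ENNReal.inv_mul_le_one _).trans_lt ENNReal.one_lt_top⟩

section Flow

variable {d D : ℕ} {H : Type*} [TopologicalSpace H]
  {I : ModelWithCorners ℝ (EuclideanSpace ℝ (Fin d)) H}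
  {X : Type*} [TopologicalSpace X] [ChartedSpace H X]
  {ι : X → EuclideanSpace ℝ (Fin D)} {Ξ : Type*} {ξ : ℝ → Ξ → Ξ}
  {F : Ξ → (x : X) → TangentSpace I x} {φ : ℝ → Ξ → X → X}

theorem IsFlowOf.hasDerivAt (hφ : IsFlowOf I ξ F φ) (hι : IsSubmanifoldInclusion I ι) (z : Ξ)
    (x : X) (t : ℝ) :
    HasDerivAt (fun s => ι (φ s z x)) (ambientField I ι F (ξ t z) (φ t z x)) t := by
  have h := (hι.mdifferentiableAt (φ t z x)).hasMFDerivAt.comp t (hφ.deriv z x t)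
  have h2 : HasFDerivAt (fun s => ι (φ s z x)) (ambientDeriv I ι (φ t z x) ∘L
      (1 : ℝ →L[ℝ] ℝ).smulRight (F (ξ t z) (φ t z x) : EuclideanSpace ℝ (Fin d))) t :=
    hasMFDerivAt_iff_hasFDerivAt.1 h
  have h3 : ∀ (A : EuclideanSpace ℝ (Fin d) →L[ℝ] EuclideanSpace ℝ (Fin D)) v,
      (A ∘L (1 : ℝ →L[ℝ] ℝ).smulRight v) 1 = A v := fun A v => by simp
  exact h2.hasDerivAt.congr_deriv (h3 _ _)

theorem IsFlowOf.continuous_time (hφ : IsFlowOf I ξ F φ) (z : Ξ) (x : X) :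
    Continuous fun t => φ t z x :=
  continuous_iff_continuousAt.2 fun t => (hφ.deriv z x t).continuousAt

theorem absDet_nonneg (Ψ : X → X) (x : X) : 0 ≤ absDet I ι Ψ x :=
  div_nonneg (mul_nonneg (abs_nonneg _) (LinearMap.normDet_nonneg _)) (LinearMap.normDet_nonneg _)

variable [IsManifold I ∞ X] [CompactSpace X]

/-- Solutions of the flow equation depend on their values at any time in a Lipschitz manner,
uniformly on bounded time intervals. -/
theorem IsRegularField.exists_dist_le (hF : IsRegularField I ι ξ F)
    (hι : IsSubmanifoldInclusion I ι) (z : Ξ) (a b : ℝ) :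
    ∃ L : ℝ≥0, ∀ p q : ℝ → X,
      (∀ t, HasDerivAt (fun s => ι (p s)) (ambientField I ι F (ξ t z) (p t)) t) →
      (∀ t, HasDerivAt (fun s => ι (q s)) (ambientField I ι F (ξ t z) (q t)) t) →
      ∀ s ∈ Icc a b, ∀ t ∈ Icc a b, dist (ι (p t)) (ι (q t)) ≤ L * dist (ι (p s)) (ι (q s)) := by
  rcases isEmpty_or_nonempty X with hX | ⟨⟨x₀⟩⟩
  · exact ⟨0, fun p => (hX.false (p 0)).elim⟩
  obtain ⟨k, hk, hb⟩ := hF.bound z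
  obtain ⟨C, hC⟩ := hι.exists_forall_dist_le
  have hk0 : ∀ t, 0 ≤ k t := fun t => (norm_nonneg _).trans (hb t x₀).1
  have hKint : LocallyIntegrable fun t => C * k t := hk.smul (C : ℝ)
  refine ⟨⟨Real.exp (∫ x in Icc a b, C * k x), (Real.exp_pos _).le⟩, fun p q hp hq s hs t ht => ?_⟩
  rw [dist_eq_norm, dist_eq_norm]
  refine norm_le_exp_integral_mul_norm (w := fun s => ι (p s) - ι (q s))
    (fun t => (hp t).sub (hq t)) hKint (fun t => mul_nonneg C.2 (hk0 t)) (fun t => ?_) hs ht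
  have := hC (ambientField I ι F (ξ t z)) (k t) (hk0 t) (hF.contMDiff _) (fun x => (hb t x).1)
    (fun x v => (hb t x).2 v) (p t) (q t)
  rwa [dist_eq_norm, dist_eq_norm] at this

/-- The cocycle property of the flow. -/
theorem IsFlowOf.add (hφ : IsFlowOf I ξ F φ) (hF : IsRegularField I ι ξ F)
    (hι : IsSubmanifoldInclusion I ι) (hξ : IsDrivingFlow ξ) (s t : ℝ) (z : Ξ) (x : X) :
    φ (s + t) z x = φ s (ξ t z) (φ t z x) := by
  -- The Lipschitz estimate serves as a uniqueness theorem: both curves solve the equation along the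
  -- orbit of `ξ t z` and agree at time `0`. The endpoints allow either sign of `s`.
  obtain ⟨L, hL⟩ := hF.exists_dist_le hι (ξ t z) (min 0 s) (max 0 s)
  have h := hL (fun r => φ (r + t) z x) (fun r => φ r (ξ t z) (φ t z x))
    (fun r => by
      rw [← hξ.add]
      exact (hφ.hasDerivAt hι z x (r + t)).comp_add_const r t)
    (fun r => hφ.hasDerivAt hι _ _ r) 0 ⟨min_le_left _ _, le_max_left _ _⟩ s
    ⟨min_le_right _ _, le_max_right _ _⟩
  simp only [zero_add, hφ.zero, dist_self, mul_zero] at h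
  exact hι.injective (dist_le_zero.1 h)

theorem IsFlowOf.leftInverse (hφ : IsFlowOf I ξ F φ) (hF : IsRegularField I ι ξ F)
    (hι : IsSubmanifoldInclusion I ι) (hξ : IsDrivingFlow ξ) (t : ℝ) (z : Ξ) :
    Function.LeftInverse (φ (-t) (ξ t z)) (φ t z) := fun x => by
  rw [← hφ.add hF hι hξ, neg_add_cancel, hφ.zero]

theorem IsFlowOf.rightInverse (hφ : IsFlowOf I ξ F φ) (hF : IsRegularField I ι ξ F)
    (hι : IsSubmanifoldInclusion I ι) (hξ : IsDrivingFlow ξ) (t : ℝ) (z : Ξ) :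
    Function.RightInverse (φ (-t) (ξ t z)) (φ t z) := fun x => by
  have h := hφ.leftInverse hF hι hξ (-t) (ξ t z) x
  rwa [neg_neg, ← hξ.add, neg_add_cancel, hξ.zero] at h

/-- The flow maps and their inverses are Lipschitz, uniformly on bounded time intervals. -/
theorem IsFlowOf.exists_dist_le (hφ : IsFlowOf I ξ F φ) (hF : IsRegularField I ι ξ F)
    (hι : IsSubmanifoldInclusion I ι) (hξ : IsDrivingFlow ξ) (z : Ξ) {a b : ℝ}
    (h0 : (0 : ℝ) ∈ Icc a b) :
    ∃ L : ℝ≥0, ∀ t ∈ Icc a b,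
      (∀ x y, dist (ι (φ t z x)) (ι (φ t z y)) ≤ L * dist (ι x) (ι y)) ∧
      ∀ x y, dist (ι (φ (-t) (ξ t z) x)) (ι (φ (-t) (ξ t z) y)) ≤ L * dist (ι x) (ι y) := by
  obtain ⟨L, hL⟩ := hF.exists_dist_le hι z a b
  refine ⟨L, fun t ht => ⟨fun x y => ?_, fun x y => ?_⟩⟩
  · have := hL (fun s => φ s z x) (fun s => φ s z y) (hφ.hasDerivAt hι z x) (hφ.hasDerivAt hι z y)
      0 h0 t ht
    simpa only [hφ.zero] using this
  -- The trajectory from `φ (-t) (ξ t z) x` passes through `x` at time `t`; reading the estimate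
  -- from time `t` back to `0` bounds the inverse.
  · have hr := hφ.rightInverse hF hι hξ t z
    have := hL (fun s => φ s z (φ (-t) (ξ t z) x)) (fun s => φ s z (φ (-t) (ξ t z) y))
      (hφ.hasDerivAt hι z _) (hφ.hasDerivAt hι z _) t ht 0 h0
    simpa only [hφ.zero, hr x, hr y] using this

variable [MeasurableSpace X] [BorelSpace X]

/-- Transfer operators preserve integrability and are dual to composition with the flow. -/
theorem IsFlowOf.integrable_perronFrobenius (hφ : IsFlowOf I ξ F φ) (hF : IsRegularField I ι ξ F)
    (hι : IsSubmanifoldInclusion I ι) (hξ : IsDrivingFlow ξ) (z : Ξ) (t : ℝ) {f : X → ℝ}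
    (hf : Integrable f (lebesgue d ι)) :
    Integrable (perronFrobenius I ι ξ φ z t f) (lebesgue d ι) ∧
    ∀ A : Set X, MeasurableSet A → ∫ x in A, perronFrobenius I ι ξ φ z t f x ∂lebesgue d ι =
      ∫ x, A.indicator (1 : X → ℝ) (φ t z x) * f x ∂lebesgue d ι := by
  obtain ⟨L, hL⟩ := hφ.exists_dist_le hF hι hξ z (a := min 0 t) (b := max 0 t)
    ⟨min_le_left _ _, le_max_left _ _⟩
  obtain ⟨hLΦ, hLΨ⟩ := hL t ⟨min_le_right _ _, le_max_right _ _⟩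
  have hl := hφ.leftInverse hF hι hξ t z
  have hr := hφ.rightInverse hF hι hξ t z
  have hΦc := hι.continuous_of_dist_le hLΦ
  have hΨc := hι.continuous_of_dist_le hLΨ
  have hemb : MeasurableEmbedding (φ (-t) (ξ t z)) :=
    (Homeomorph.mk ⟨_, _, hr, hl⟩ hΨc hΦc).measurableEmbedding
  obtain ⟨hjm, hmap⟩ := hι.map_withDensity_absDet hLΨ hLΦ hr hl
  have hjm' : AEMeasurable (absDet I ι (φ (-t) (ξ t z))) (lebesgue d ι) :=
    hjm.smul_measure _
  have hmap' : ((lebesgue d ι).withDensity fun x =>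
      ENNReal.ofReal (absDet I ι (φ (-t) (ξ t z)) x)).map (φ (-t) (ξ t z)) = lebesgue d ι := by
    rw [show lebesgue d ι = (surfaceMeasure d ι univ)⁻¹ • surfaceMeasure d ι from rfl,
      withDensity_smul_measure, Measure.map_smul, hmap]
  refine ⟨(integrable_and_integral_comp_mul hemb hjm' (absDet_nonneg _) hmap' hf).1,
    fun A hA => ?_⟩
  -- Change of variables is applied to `χ_A(φ_t x) f(x)`: composed with the inverse flow and
  -- multiplied by the Jacobian, it becomes `χ_A · 𝒫^{(t)} f`.
  have hg : Integrable (fun x => A.indicator (1 : X → ℝ) (φ t z x) * f x) (lebesgue d ι) := by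
    refine hf.bdd_mul (c := 1) ?_ (Eventually.of_forall fun x => ?_)
    · exact ((measurable_one.indicator hA).comp hΦc.measurable).aestronglyMeasurable
    · by_cases h : φ t z x ∈ A <;> simp [h]
  rw [← (integrable_and_integral_comp_mul hemb hjm' (absDet_nonneg _) hmap' hg).2,
    ← integral_indicator hA]
  refine integral_congr_ae (Eventually.of_forall fun x => ?_)
  by_cases h : x ∈ A <;> simp [h, hr x, perronFrobenius]

/-- Integrals of transferred bounded functions over measurable sets depend continuously on time. -/
theorem IsFlowOf.tendsto_setIntegral_perronFrobenius (hφ : IsFlowOf I ξ F φ)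
    (hF : IsRegularField I ι ξ F) (hι : IsSubmanifoldInclusion I ι) (hξ : IsDrivingFlow ξ) (z : Ξ)
    (t₀ : ℝ) {f : X → ℝ} (hf : Measurable f) {M : ℝ} (hM : ∀ x, |f x| ≤ M) {A : Set X}
    (hA : MeasurableSet A) :
    Tendsto (fun t => ∫ x in A, perronFrobenius I ι ξ φ z t f x ∂lebesgue d ι) (𝓝 t₀)
      (𝓝 (∫ x in A, perronFrobenius I ι ξ φ z t₀ f x ∂lebesgue d ι)) := by
  have := hι.polishSpace
  have := isFiniteMeasure_lebesgue (d := d) (ι := ι)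
  have hfi : Integrable f (lebesgue d ι) :=
    Integrable.of_bound hf.aestronglyMeasurable M (Eventually.of_forall hM)
  simp only [fun t => (hφ.integrable_perronFrobenius hF hι hξ z t hfi).2 A hA]
  -- The interval contains `0`, where the flow is the identity, and a neighbourhood of `t₀`. The
  -- preimage of a set under `φ t z` is its image under the `L`-Lipschitz inverse, hence `C = L ^
  -- d`.
  obtain ⟨L, hL⟩ := hφ.exists_dist_le hF hι hξ z (a := min 0 (t₀ - 1)) (b := max 0 (t₀ + 1))
    ⟨min_le_left _ _, le_max_left _ _⟩
  refine tendsto_integral_indicator_comp_mul (C := L ^ d)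
    (fun x => (hφ.continuous_time z x).tendsto t₀) ?_ hf hM hA
  filter_upwards [Icc_mem_nhds (sub_one_lt t₀) (lt_add_one t₀)] with t ht
  obtain ⟨hLΦ, hLΨ⟩ := hL t
    ⟨(min_le_right _ _).trans ht.1, ht.2.trans (le_max_right _ _)⟩
  have hm : Measurable (φ t z) := (hι.continuous_of_dist_le hLΦ).measurable
  refine ⟨hm, Measure.le_iff.2 fun S hS => ?_⟩
  rw [Measure.map_apply hm hS, ← image_eq_preimage_of_inverse (hφ.rightInverse hF hι hξ t z)
    (hφ.leftInverse hF hι hξ t z),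
    show lebesgue d ι = (surfaceMeasure d ι univ)⁻¹ • surfaceMeasure d ι from rfl]
  simp only [Measure.smul_apply, smul_eq_mul, ENNReal.coe_pow]
  rw [mul_left_comm]
  gcongr
  exact hι.surfaceMeasure_image_le hLΨ S

end Flow

/-! ### Step functions: from coefficients to `L¹` norms -/

section StepFunction

variable {X : Type*} {n : ℕ}

theorem abs_stepFunction_le (B : Fin n → Set X) (u : Fin n → ℝ) (x : X) :
    |stepFunction B u x| ≤ ∑ i, |u i| := by
  refine (Finset.abs_sum_le_sum_abs _ _).trans (Finset.sum_le_sum fun i _ => ?_)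
  rw [abs_mul]
  refine mul_le_of_le_one_right (abs_nonneg _) ?_
  by_cases h : x ∈ B i <;> simp [h]

theorem stepFunction_sub (B : Fin n → Set X) (u v : Fin n → ℝ) :
    stepFunction B u - stepFunction B v = stepFunction B (u - v) := by
  funext x
  simp [stepFunction, sub_mul]

theorem measurable_stepFunction [MeasurableSpace X] {B : Fin n → Set X}
    (hB : ∀ i, MeasurableSet (B i)) (u : Fin n → ℝ) : Measurable (stepFunction B u) :=
  Finset.measurable_fun_sum _ fun i _ => (measurable_one.indicator (hB i)).const_mul (u i)

/-- The difference is bounded everywhere by the sum of the coefficient differences, and the measure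
is finite. -/
theorem tendsto_eLpNorm_stepFunction_sub [MeasurableSpace X] {m : Measure X} [IsFiniteMeasure m]
    (B : Fin n → Set X) {α : Type*} {l : Filter α} {v : α → Fin n → ℝ} {w : Fin n → ℝ}
    (h : Tendsto v l (𝓝 w)) :
    Tendsto (fun a => eLpNorm (stepFunction B (v a) - stepFunction B w) 1 m) l (𝓝 0) := by
  have hsum : Tendsto (fun a => ∑ i, |v a i - w i|) l (𝓝 0) := by
    have h1 : Tendsto (fun a => ∑ i, |v a i - w i|) l (𝓝 (∑ i, |w i - w i|)) :=
      tendsto_finsetSum _ fun i _ => (((tendsto_pi_nhds.1 h) i).sub_const _).abs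
    simpa using h1
  have hbd : Tendsto (fun a => m univ * ENNReal.ofReal (∑ i, |v a i - w i|)) l (𝓝 0) := by
    have := ENNReal.Tendsto.const_mul (a := m univ) (ENNReal.tendsto_ofReal hsum)
      (Or.inr (measure_ne_top m univ))
    simpa using this
  refine tendsto_of_tendsto_of_tendsto_of_le_of_le tendsto_const_nhds hbd (fun _ => zero_le)
    fun a => ?_
  simp only [stepFunction_sub]
  have := eLpNorm_le_of_ae_bound (p := 1) (μ := m) (f := stepFunction B (v a - w))
    (Eventually.of_forall (abs_stepFunction_le B (v a - w)))
  simpa using this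

end StepFunction

end OseledetsUlam

end Auxiliary

/-! ### Proof of the proposition -/

theorem mainTheorem1 {d D : ℕ} {H : Type*} [TopologicalSpace H]
    (I : ModelWithCorners ℝ (EuclideanSpace ℝ (Fin d)) H)
    {X : Type*} [TopologicalSpace X] [ChartedSpace H X] [IsManifold I ∞ X] [CompactSpace X]
    [MeasurableSpace X] [BorelSpace X]
    (ι : X → EuclideanSpace ℝ (Fin D)) (hι : IsSubmanifoldInclusion I ι)
    {Ξ : Type*} (ξ : ℝ → Ξ → Ξ) (hξ : IsDrivingFlow ξ)
    (F : Ξ → (x : X) → TangentSpace I x) (hF : IsRegularField I ι ξ F)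
    (φ : ℝ → Ξ → X → X) (hφ : IsFlowOf I ξ F φ)
    {n : ℕ} (B : Fin n → Set X) (hB : IsUlamPartition (lebesgue d ι) B)
    (T N : ℝ) (hT : 0 < T) (hN : 0 ≤ N) (z : Ξ)
    (hU : Module.finrank ℝ (singularSpace I ι ξ φ B T (ξ (-N) z) 2) = 1)
    (u : Ξ → Fin n → ℝ)
    (hu : u (ξ (-N) z) ∈ singularSpace I ι ξ φ B T (ξ (-N) z) 2)
    (hu1 : MeasureTheory.eLpNorm (stepFunction B (u (ξ (-N) z))) 1 (lebesgue d ι) = 1) :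
    (∀ t : ℝ, MeasureTheory.Integrable
      (perronFrobenius I ι ξ φ (ξ (-N) z) t (stepFunction B (u (ξ (-N) z)))) (lebesgue d ι)) ∧
    Filter.Tendsto
      (fun δ : ℝ => MeasureTheory.eLpNorm
        (oseledetsApprox I ι ξ φ B u (ξ δ z) (N + δ) - oseledetsApprox I ι ξ φ B u z N)
        1 (lebesgue d ι))
      (𝓝 0) (𝓝 0) := by
  have := isFiniteMeasure_lebesgue (d := d) (ι := ι)
  have hfm := measurable_stepFunction hB.measurable (u (ξ (-N) z))
  have hfb := abs_stepFunction_le B (u (ξ (-N) z))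
  refine ⟨fun t => (hφ.integrable_perronFrobenius hF hι hξ _ t (MeasureTheory.Integrable.of_bound
    hfm.aestronglyMeasurable _ (Filter.Eventually.of_forall hfb))).1, ?_⟩
  -- The two shifts cancel, so the same vector `u (ξ (-N) z)` appears for every `δ` and only the
  -- transfer time varies.
  have hy : ∀ δ : ℝ, ξ (-(N + δ)) (ξ δ z) = ξ (-N) z := fun δ => by
    rw [← hξ.add]; congr 1; ring
  simp only [oseledetsApprox, hy, ulamProj]
  refine tendsto_eLpNorm_stepFunction_sub B (tendsto_pi_nhds.2 fun i => ?_)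
  have h0 : Filter.Tendsto (fun δ : ℝ => N + δ) (𝓝 0) (𝓝 N) := by
    have h : Filter.Tendsto (fun δ : ℝ => N + δ) (𝓝 0) (𝓝 (N + 0)) :=
      Continuous.tendsto (by fun_prop) 0
    simpa using h
  exact ((hφ.tendsto_setIntegral_perronFrobenius hF hι hξ (ξ (-N) z) N hfm hfb
    (hB.measurable i)).comp h0).div_const _
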